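/- Fix a universe $\mathfrak U$; "small" means $\mathfrak U$-small, sheaves and presheaves are of small sets, and $\circ$ is the usual composition. **Definitions.** Let $\mathcal C$ be a category. A collection $\mathcal T$ of morphisms is *semi-localizing* if it contains all identities, is closed under composition, and for every $Y_1\xrightarrow{f_1}X\xleftarrow{f_2}Y_2$ with $f_1\in\mathcal T$ there are $g_1:Z\to Y_1$ and $g_2:Z\to Y_2$ with $g_2\in\mathcal T$ and $f_1\circ g_1=f_2\circ g_2$. A Grothendieck topology $J$ on $\mathcal C$ is an *$A$-topology* if for some semi-localizing $\mathcal T$ the covering sieves are exactly the sieves containing a member of $\mathcal T$. Let $\mathcal T(J)$ be the collection of morphisms $f:Y\to X$ that generate a covering sieve of $X$, and let $\mathcal C(\mathcal T(J))$ be the subcategory of $\mathcal C$ with all objects and with the morphisms in $\mathcal T(J)$. For a collection $\mathcal T$, let $\widehat{\mathcal T}$ be the collection of all $f$ such that $f\circ g\in\mathcal T$ for some $g$. A morphism $f:Y\to X$ is a *Galois covering* if there are a group $G$ and a homomorphism $\rho:G\to\mathrm{Aut}_X(Y)$ such that for every object $Z$ the group $G$ (acting through $\rho$ by composition) acts freely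 on $\mathrm{Hom}(Z,Y)$ and the map $G\backslash\mathrm{Hom}(Z,Y)\to\mathrm{Hom}(Z,X)$ induced by $f$ is injective. A category is *$\Lambda$-connected* if any two objects receive morphisms from a common object. The site $(\mathcal C,J)$ is a *$Y$-site* if: every morphism of $\mathcal C$ is an epimorphism; $J$ is an $A$-topology; $f\circ g\in\mathcal T(J)$ if and only if $f\in\mathcal T(J)$ and $g\in\mathcal T(J)$; $\mathcal C$ is essentially small; $\mathcal C(\mathcal T(J))$ is $\Lambda$-connected; and $\widehat{\mathcal T'}=\widehat{\mathcal T(J)}$, where $\mathcal T'$ is the collection of Galois coverings that belong to $\mathcal T(J)$. Let $\mathcal C_0$ be a small poset, regarded as a category with a unique morphism $x\to y$ when $x\le y$, and let $\iota_0:\mathcal C_0\to\mathcal C$ be a functor. An object $X$ of $\mathcal C_0$ is an *edge object* if $\iota_0(f)\in\mathcal T(J)$ for every morphism $f:Y\to X$ of $\mathcal C_0$. The pair $(\mathcal C_0,\iota_0)$ is a *grid* of $(\mathcal C,J)$ if: $\mathcal C_0$ is $\Lambda$-connected; every object of $\mathcal C$ is isomorphic to $\iota_0(X)$ for some edge object $X$;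 for every object $X$ of $\mathcal C_0$ and every $f:Y\to\iota_0(X)$ in $\mathcal T(J)$ there are $f':Y'\to X$ in $\mathcal C_0$ and an isomorphism $a:Y\cong\iota_0(Y')$ with $f=\iota_0(f')\circ a$; and for every object $X$ of $\mathcal C_0$ the functor $\mathcal C_{0,X/}\to\mathcal C_{\iota_0(X)/}$ of undercategories induced by $\iota_0$ is an equivalence. The *absolute Galois monoid* $M=M_{(\mathcal C_0,\iota_0)}$ consists of the pairs $(\alpha,\gamma_\alpha)$ of a functor $\alpha:\mathcal C_0\to\mathcal C_0$ and a natural isomorphism $\gamma_\alpha:\iota_0\cong\iota_0\circ\alpha$, with $(\alpha,\gamma_\alpha)(\beta,\gamma_\beta)=(\alpha\circ\beta,(\beta^*\gamma_\alpha)\circ\gamma_\beta)$. For an object $X$ of $\mathcal C_0$ let $\mathbb K_X\subset M$ be the submonoid of the $(\alpha,\gamma_\alpha)$ with $\alpha(X)=X$ and $\gamma_\alpha(X)=\mathrm{id}_{\iota_0(X)}$. A small left $M$-set $S$ is *smooth* if every $s\in S$ is fixed by $\mathbb K_X$ for some edge object $X$; morphisms of smooth sets are the $M$-equivariant maps. For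 a sheaf $F$ put $\omega(F)=\varinjlim_X F(\iota_0(X))$, the colimit over the edge objects $X$ of $\mathcal C_0$; it agrees with the colimit over all objects of $\mathcal C_0$, and $(\alpha,\gamma_\alpha)\in M$ acts on it by sending the class of $x\in F(\iota_0(X))$ to the class of $(\gamma_\alpha(X)^{-1})^*x\in F(\iota_0(\alpha(X)))$. This makes $\omega(F)$ a smooth $M$-set and defines the *fiber functor* $\omega$ from the category $\mathrm{Shv}(\mathcal C,J)$ of sheaves on $(\mathcal C,J)$ to the category of smooth $M$-sets. **Theorem.** Let $(\mathcal C,J)$ be a $Y$-site and let $(\mathcal C_0,\iota_0)$ be a grid of it. Then the fiber functor $\omega:\mathrm{Shv}(\mathcal C,J)\to(\text{smooth }M_{(\mathcal C_0,\iota_0)}\text{-sets})$ is faithful. If moreover, for each object $X$ of $\mathcal C$, the overcategory $\mathcal D=\mathcal C(\mathcal T(J))_{/X}$ satisfies at least one of the two conditions 1. $\mathrm{Hom}_{\mathcal D}(A,B)$ is finite for all objects $A,B$ of $\mathcal D$; 2. there is an at most countable set $S$ of objects of $\mathcal D$ such that every object of $\mathcal D$ receives a morphism from a member of $S$; then $\omega$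 is an equivalence of categories. -/

import Mathlib

open CategoryTheory CategoryTheory.Limits Opposite

universe w v u

namespace YSites

section Topology

variable {C : Type u} [Category.{v} C]

/-- A collection `T` of morphisms is semi-localizing: it contains the identities, is closed under
composition, and satisfies the right Ore condition. -/
structure IsSemiLocalizing (T : MorphismProperty C) : Prop where
  id_mem : ∀ X : C, T (𝟙 X)
  comp_mem : ∀ {X Y Z : C} (g : Z ⟶ Y) (f : Y ⟶ X), T g → T f → T (g ≫ f)
  ore : ∀ {Y₁ Y₂ X : C} (f₁ : Y₁ ⟶ X) (f₂ : Y₂ ⟶ X), T f₁ →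
    ∃ (Z : C) (g₁ : Z ⟶ Y₁) (g₂ : Z ⟶ Y₂), T g₂ ∧ g₁ ≫ f₁ = g₂ ≫ f₂

/-- `J` is an `A`-topology: for some semi-localizing `T`, the covering sieves are exactly the
sieves containing a member of `T`. -/
def IsATopology (J : GrothendieckTopology C) : Prop :=
  ∃ T : MorphismProperty C, IsSemiLocalizing T ∧
    ∀ (X : C) (R : Sieve X), R ∈ J X ↔ ∃ (Y : C) (f : Y ⟶ X), R f ∧ T f

/-- `T(J)`: the morphisms `f : Y ⟶ X` such that the sieve generated by `f` covers `X`. -/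
def coverMor (J : GrothendieckTopology C) : MorphismProperty C :=
  fun _ X f => Sieve.generate (Presieve.singleton f) ∈ J X

/-- The collection of those `f` for which `f ∘ g` lies in `T` for some `g`. -/
def hat (T : MorphismProperty C) : MorphismProperty C :=
  fun Y _ f => ∃ (Z : C) (g : Z ⟶ Y), T (g ≫ f)

instance coverMor_isMultiplicative (J : GrothendieckTopology C) :
    (coverMor J).IsMultiplicative where
  id_mem X := by
    have h : Sieve.generate (Presieve.singleton (𝟙 X)) = ⊤ :=
      (Sieve.id_mem_iff_eq_top).1 (Sieve.le_generate _ _ _ Presieve.singleton.mk)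
    show _ ∈ J X
    rw [h]
    exact J.top_mem X
  comp_mem {Z Y X} g f hg hf := by
    refine J.transitive hf _ ?_
    rintro W h ⟨V, k, m, hm, rfl⟩
    cases hm
    refine J.superset_covering ?_ (J.pullback_stable k hg)
    rintro U l ⟨V', k', m', hm', e⟩
    cases hm'
    exact ⟨_, k', _, Presieve.singleton.mk, by rw [← Category.assoc, e, Category.assoc]⟩

/-- `C(T(J))`: the subcategory of `C` with all objects and with the morphisms in `T(J)`. -/
abbrev CoverCat (J : GrothendieckTopology C) : Type u := WideSubcategory (coverMor J)

/-- Any two objects receive morphisms from a common object. -/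
def IsLambdaConnected (D : Type*) [Category* D] : Prop :=
  ∀ X Y : D, ∃ Z : D, Nonempty (Z ⟶ X) ∧ Nonempty (Z ⟶ Y)

end Topology

section Galois

/-- `φ : S → S'` is a pseudo `G`-torsor: it is `G`-invariant, `G` acts freely on `S`, and the
induced map `G \ S → S'` is injective. -/
structure IsPseudoTorsor (G : Type*) [Group G] {S S' : Type*} [MulAction G S] (φ : S → S') :
    Prop where
  invariant : ∀ (g : G) (s : S), φ (g • s) = φ s
  free : ∀ (g : G) (s : S), g • s = s → g = 1
  injective : ∀ s t : S, φ s = φ t → ∃ g : G, g • s = t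

variable {C : Type u} [Category.{v} C]

/-- A homomorphism `ρ : G → Aut_X(Y)` lets `G` act on `Hom(Z, Y)` by composition with `ρ g`. -/
@[reducible]
def homAction {X Y : C} {f : Y ⟶ X} {G : Type*} [Group G] (ρ : G →* Aut (Over.mk f)) (Z : C) :
    MulAction G (Z ⟶ Y) where
  smul g h := h ≫ (ρ g).hom.left
  one_smul h := by
    show h ≫ (ρ 1).hom.left = h
    rw [map_one]
    exact Category.comp_id h
  mul_smul a b h := by
    show h ≫ (ρ (a * b)).hom.left = (h ≫ (ρ b).hom.left) ≫ (ρ a).hom.left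
    rw [map_mul, Category.assoc]
    rfl

/-- `f : Y ⟶ X` is a Galois covering. -/
def IsGaloisCovering {X Y : C} (f : Y ⟶ X) : Prop :=
  ∃ (G : Type v) (_ : Group G) (ρ : G →* Aut (Over.mk f)), ∀ Z : C,
    letI := homAction ρ Z
    IsPseudoTorsor G (fun h : Z ⟶ Y => h ≫ f)

/-- `T` has enough Galois coverings: the collection `T'` of Galois coverings in `T` has the same
hat as `T`. -/
def HasEnoughGalois (T : MorphismProperty C) : Prop :=
  hat (fun _ _ f => T f ∧ IsGaloisCovering f) = hat T

/-- `B`-sites: every morphism is an epimorphism, `J` is an `A`-topology, and a composite is in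
`T(J)` if and only if both factors are. -/
structure IsBSite (J : GrothendieckTopology C) : Prop where
  epi : ∀ {X Y : C} (f : X ⟶ Y), Epi f
  isATopology : IsATopology J
  comp_iff : ∀ {X Y Z : C} (g : Z ⟶ Y) (f : Y ⟶ X),
    coverMor J (g ≫ f) ↔ coverMor J f ∧ coverMor J g

/-- `Y`-sites, relative to the universe `Type w` of small sets. -/
structure IsYSite (J : GrothendieckTopology C) : Prop extends IsBSite J where
  essentiallySmall : EssentiallySmall.{w} C
  lambdaConnected : IsLambdaConnected (CoverCat J)
  enoughGalois : HasEnoughGalois (coverMor J)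

/-- First cardinality condition: all hom sets are finite. -/
def HomFinite (D : Type*) [Category* D] : Prop :=
  ∀ X Y : D, Finite (X ⟶ Y)

/-- Second cardinality condition: there is an at most countable set of objects such that every object
receives a morphism from a member of that set. -/
def CountablyGenerated (D : Type*) [Category* D] : Prop :=
  ∃ S : Set D, S.Countable ∧ ∀ X : D, ∃ s ∈ S, Nonempty (s ⟶ X)

end Galois

section Grid

variable {C : Type u} [Category.{v} C]

/-- `X` is an edge object of `C₀`: `ι₀ f` is in `T(J)` for every morphism `f : Y ⟶ X` of `C₀`. -/
def IsEdge (J : GrothendieckTopology C) {C₀ : Type w} [PartialOrder C₀] (ι₀ : C₀ ⥤ C) :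
    ObjectProperty C₀ :=
  fun X => ∀ (Y : C₀) (f : Y ⟶ X), coverMor J (ι₀.map f)

/-- `(C₀, ι₀)` is a grid of `(C, J)`; the poset `C₀` is regarded as a category with a unique
morphism `x ⟶ y` whenever `x ≤ y`. -/
structure IsGrid (J : GrothendieckTopology C) {C₀ : Type w} [PartialOrder C₀] (ι₀ : C₀ ⥤ C) :
    Prop where
  lambdaConnected : IsLambdaConnected C₀
  exists_edge : ∀ X' : C, ∃ X : C₀, IsEdge J ι₀ X ∧ Nonempty (ι₀.obj X ≅ X')
  exists_lift : ∀ (X : C₀) {Y : C} (f : Y ⟶ ι₀.obj X), coverMor J f →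
    ∃ (Y' : C₀) (f' : Y' ⟶ X) (a : Y ≅ ι₀.obj Y'), f = a.hom ≫ ι₀.map f'
  under_equivalence : ∀ X : C₀, (Under.post ι₀ : Under X ⥤ Under (ι₀.obj X)).IsEquivalence

/-- The underlying set of the absolute Galois monoid of `(C₀, ι₀)`. -/
structure GaloisMonoid {C₀ : Type w} [PartialOrder C₀] (ι₀ : C₀ ⥤ C) where
  /-- an endofunctor of `C₀` -/
  α : C₀ ⥤ C₀
  /-- a natural isomorphism from `ι₀` to `ι₀ ∘ α` -/
  γ : ι₀ ≅ α ⋙ ι₀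

variable {C₀ : Type w} [PartialOrder C₀] {ι₀ : C₀ ⥤ C}

namespace GaloisMonoid

/-- `(α, γ_α) ∘ (β, γ_β) = (α ∘ β, (β^* γ_α) ∘ γ_β)` -/
instance : Mul (GaloisMonoid ι₀) where
  mul a b :=
    ⟨b.α ⋙ a.α, b.γ ≪≫ Functor.isoWhiskerLeft b.α a.γ ≪≫ (Functor.associator _ _ _).symm⟩

instance : One (GaloisMonoid ι₀) where
  one := ⟨𝟭 C₀, (Functor.leftUnitor ι₀).symm⟩

theorem mul_α (a b : GaloisMonoid ι₀) : (a * b).α = b.α ⋙ a.α := rfl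

theorem one_α : (1 : GaloisMonoid ι₀).α = 𝟭 C₀ := rfl

theorem mul_γ_hom_app (a b : GaloisMonoid ι₀) (X : C₀) :
    (a * b).γ.hom.app X = b.γ.hom.app X ≫ a.γ.hom.app (b.α.obj X) :=
  congrArg (b.γ.hom.app X ≫ ·) (Category.comp_id (a.γ.hom.app (b.α.obj X)))

theorem mul_γ_inv_app (a b : GaloisMonoid ι₀) (X : C₀) :
    (a * b).γ.inv.app X = a.γ.inv.app (b.α.obj X) ≫ b.γ.inv.app X :=
  congrArg (· ≫ b.γ.inv.app X) (Category.id_comp (a.γ.inv.app (b.α.obj X)))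

theorem one_γ_hom_app (X : C₀) : (1 : GaloisMonoid ι₀).γ.hom.app X = 𝟙 (ι₀.obj X) := rfl

theorem one_γ_inv_app (X : C₀) : (1 : GaloisMonoid ι₀).γ.inv.app X = 𝟙 (ι₀.obj X) := rfl

theorem mk_congr {α : C₀ ⥤ C₀} {γ γ' : ι₀ ≅ α ⋙ ι₀}
    (h : ∀ X, γ.hom.app X = γ'.hom.app X) : (⟨α, γ⟩ : GaloisMonoid ι₀) = ⟨α, γ'⟩ := by
  have : γ = γ' := by
    ext X
    exact h X
  rw [this]

/-- The absolute Galois monoid. -/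
instance : Monoid (GaloisMonoid ι₀) where
  mul_assoc a b c := mk_congr fun X => by
    have h₁ := (mul_γ_hom_app (a * b) c X).trans
      (congrArg (c.γ.hom.app X ≫ ·) (mul_γ_hom_app a b (c.α.obj X)))
    have h₂ := (mul_γ_hom_app a (b * c) X).trans
      (congrArg (· ≫ a.γ.hom.app (b.α.obj (c.α.obj X))) (mul_γ_hom_app b c X))
    exact h₁.trans ((Category.assoc _ _ _).symm.trans h₂.symm)
  one_mul a := mk_congr fun X => (mul_γ_hom_app 1 a X).trans (Category.comp_id _)
  mul_one a := mk_congr fun X => (mul_γ_hom_app a 1 X).trans (Category.id_comp _)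

end GaloisMonoid

/-- The submonoid `K_X` of the `(α, γ)` with `α X = X` and `γ X = id`. -/
def stab (ι₀ : C₀ ⥤ C) (X : C₀) : Submonoid (GaloisMonoid ι₀) where
  carrier := {a | ∃ h : a.α.obj X = X,
    a.γ.hom.app X = eqToHom (congrArg ι₀.obj h.symm : ι₀.obj X = ι₀.obj (a.α.obj X))}
  one_mem' := ⟨rfl, rfl⟩
  mul_mem' := by
    rintro a b ⟨ha, ha'⟩ ⟨hb, hb'⟩
    refine ⟨(congrArg a.α.obj hb).trans ha, ?_⟩
    have key : ∀ (Y : C₀) (hY : X = Y), a.γ.hom.app Y =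
        eqToHom (by subst hY; exact congrArg ι₀.obj ha.symm) := by
      rintro Y rfl
      exact ha'
    rw [GaloisMonoid.mul_γ_hom_app, hb', key _ hb.symm]
    exact eqToHom_trans _ _

/-- A left `M`-set is smooth if every element is fixed by `K_X` for some edge object `X`. -/
def IsSmooth (J : GrothendieckTopology C) (ι₀ : C₀ ⥤ C) :
    ObjectProperty (Action (Type w) (GaloisMonoid ι₀)) :=
  fun S => ∀ s : S.V, ∃ X : C₀, IsEdge J ι₀ X ∧ ∀ g ∈ stab ι₀ X, (S.ρ g : S.V ⟶ S.V) s = s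

/-- The category of smooth sets of the absolute Galois monoid. -/
abbrev SmoothSet (J : GrothendieckTopology C) (ι₀ : C₀ ⥤ C) :=
  (IsSmooth J ι₀).FullSubcategory

end Grid

section FiberFunctor

variable {C : Type u} [Category.{v} C] {J : GrothendieckTopology C}
  {C₀ : Type w} [PartialOrder C₀] {ι₀ : C₀ ⥤ C}

theorem edge_of_hom (hB : IsBSite J) {X Y : C₀} (hX : IsEdge J ι₀ X) (f : Y ⟶ X) :
    IsEdge J ι₀ Y := by
  intro Z g
  have h := hX Z (g ≫ f)
  rw [ι₀.map_comp] at h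
  exact ((hB.comp_iff _ _).1 h).2

/-- The edge objects are cofinal in `C₀`. -/
theorem edge_final (hB : IsBSite J) (hG : IsGrid J ι₀) : (IsEdge J ι₀).ι.op.Final := by
  have : IsCodirectedOrder C₀ := ⟨fun X Y => by
    obtain ⟨Z, ⟨f⟩, ⟨g⟩⟩ := hG.lambdaConnected X Y
    exact ⟨Z, leOfHom f, leOfHom g⟩⟩
  have : (IsEdge J ι₀).ι.Initial := by
    refine Functor.initial_of_exists_of_isCofiltered_of_fullyFaithful _ fun X => ?_
    obtain ⟨E, hE, -⟩ := hG.exists_edge (ι₀.obj X)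
    obtain ⟨Z, ⟨f⟩, ⟨g⟩⟩ := hG.lambdaConnected X E
    exact ⟨⟨Z, edge_of_hom hB hE g⟩, ⟨f⟩⟩
  infer_instance

/-- `ω(F)`: the colimit of `F (ι₀ X)` over the edge objects `X` of `C₀`. -/
noncomputable abbrev fiber (J : GrothendieckTopology C) (ι₀ : C₀ ⥤ C) (F : Cᵒᵖ ⥤ Type w) :
    Type w :=
  colimit ((IsEdge J ι₀).ι.op ⋙ ι₀.op ⋙ F)

/-- The bijection from `ω(F)` to the colimit of `F (ι₀ X)` over all objects `X` of `C₀`. -/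
noncomputable def fiberIso (hB : IsBSite J) (hG : IsGrid J ι₀) (F : Cᵒᵖ ⥤ Type w) :
    fiber J ι₀ F ≅ colimit (ι₀.op ⋙ F) :=
  haveI := edge_final hB hG
  Functor.Final.colimitIso (IsEdge J ι₀).ι.op (ι₀.op ⋙ F)

/-- The maps `(γ_X⁻¹)^* : F (ι₀ X) → F (ι₀ (α X))`. -/
def pullInv (F : Cᵒᵖ ⥤ Type w) (a : GaloisMonoid ι₀) :
    ι₀.op ⋙ F ⟶ a.α.op ⋙ ι₀.op ⋙ F :=
  Functor.whiskerRight (NatTrans.op a.γ.inv) F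

/-- The action of `a = (α, γ)` on `ω(F)`: apply `(γ⁻¹)^*`, regard the result in the colimit over
all of `C₀`, and go back to `ω(F)`. -/
noncomputable def act (hB : IsBSite J) (hG : IsGrid J ι₀) (F : Cᵒᵖ ⥤ Type w)
    (a : GaloisMonoid ι₀) : fiber J ι₀ F ⟶ fiber J ι₀ F :=
  colimMap (Functor.whiskerLeft (IsEdge J ι₀).ι.op (pullInv F a)) ≫
    colimit.pre (ι₀.op ⋙ F) ((IsEdge J ι₀).ι.op ⋙ a.α.op) ≫ (fiberIso hB hG F).inv

/-- The analogous self-map of the colimit over all of `C₀`. -/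
noncomputable def actAll (F : Cᵒᵖ ⥤ Type w) (a : GaloisMonoid ι₀) :
    colimit (ι₀.op ⋙ F) ⟶ colimit (ι₀.op ⋙ F) :=
  colimMap (pullInv F a) ≫ colimit.pre (ι₀.op ⋙ F) a.α.op

theorem ι_actAll (F : Cᵒᵖ ⥤ Type w) (a : GaloisMonoid ι₀) (X : C₀) :
    colimit.ι (ι₀.op ⋙ F) (op X) ≫ actAll F a =
      F.map (a.γ.inv.app X).op ≫ colimit.ι (ι₀.op ⋙ F) (op (a.α.obj X)) := by
  unfold actAll
  rw [ι_colimMap_assoc, colimit.ι_pre]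
  rfl

theorem ι_fiberIso_hom (hB : IsBSite J) (hG : IsGrid J ι₀) (F : Cᵒᵖ ⥤ Type w)
    (X : (IsEdge J ι₀).FullSubcategory) :
    colimit.ι ((IsEdge J ι₀).ι.op ⋙ ι₀.op ⋙ F) (op X) ≫ (fiberIso hB hG F).hom =
      colimit.ι (ι₀.op ⋙ F) (op X.obj) :=
  colimit.ι_pre (ι₀.op ⋙ F) (IsEdge J ι₀).ι.op (op X)

theorem ι_act (hB : IsBSite J) (hG : IsGrid J ι₀) (F : Cᵒᵖ ⥤ Type w)
    (a : GaloisMonoid ι₀) (X : (IsEdge J ι₀).FullSubcategory) :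
    colimit.ι ((IsEdge J ι₀).ι.op ⋙ ι₀.op ⋙ F) (op X) ≫ act hB hG F a =
      F.map (a.γ.inv.app X.obj).op ≫ colimit.ι (ι₀.op ⋙ F) (op (a.α.obj X.obj)) ≫
        (fiberIso hB hG F).inv := by
  unfold act
  rw [ι_colimMap_assoc]
  have h := colimit.ι_pre (ι₀.op ⋙ F) ((IsEdge J ι₀).ι.op ⋙ a.α.op) (op X)
  exact congrArg (fun t => F.map (a.γ.inv.app X.obj).op ≫ t ≫ (fiberIso hB hG F).inv) h

theorem act_eq (hB : IsBSite J) (hG : IsGrid J ι₀) (F : Cᵒᵖ ⥤ Type w) (a : GaloisMonoid ι₀) :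
    act hB hG F a = (fiberIso hB hG F).hom ≫ actAll F a ≫ (fiberIso hB hG F).inv := by
  refine colimit.hom_ext fun X => ?_
  refine (ι_act hB hG F a X.unop).trans ?_
  rw [← Category.assoc (colimit.ι _ X)]
  have h := ι_fiberIso_hom hB hG F X.unop
  refine Eq.trans ?_ (congrArg (· ≫ actAll F a ≫ (fiberIso hB hG F).inv) h).symm
  have h' := congrArg (· ≫ (fiberIso hB hG F).inv) (ι_actAll F a X.unop.obj)
  simp only [Category.assoc] at h'
  exact h'.symm

theorem actAll_one (F : Cᵒᵖ ⥤ Type w) : actAll F (1 : GaloisMonoid ι₀) = 𝟙 _ := by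
  refine colimit.hom_ext fun X => ?_
  refine (ι_actAll F 1 X.unop).trans ?_
  rw [GaloisMonoid.one_γ_inv_app]
  refine (congrArg (· ≫ colimit.ι (ι₀.op ⋙ F) X) (F.map_id (op (ι₀.obj X.unop)))).trans ?_
  exact (Category.id_comp _).trans (Category.comp_id _).symm

theorem actAll_mul (F : Cᵒᵖ ⥤ Type w) (a b : GaloisMonoid ι₀) :
    actAll F (a * b) = actAll F b ≫ actAll F a := by
  refine colimit.hom_ext fun X => ?_
  refine (ι_actAll F (a * b) X.unop).trans ?_
  have h₁ := congrArg (· ≫ actAll F a) (ι_actAll F b X.unop)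
  have h₂ := congrArg (F.map (b.γ.inv.app X.unop).op ≫ ·) (ι_actAll F a (b.α.obj X.unop))
  simp only [Category.assoc] at h₁
  refine Eq.trans ?_ (h₁.trans h₂).symm
  rw [GaloisMonoid.mul_γ_inv_app]
  refine (congrArg (· ≫ colimit.ι (ι₀.op ⋙ F) (op (a.α.obj (b.α.obj X.unop))))
    (F.map_comp (b.γ.inv.app X.unop).op (a.γ.inv.app (b.α.obj X.unop)).op)).trans ?_
  exact Category.assoc _ _ _

/-- The left `M`-set `ω(F)`. -/
noncomputable def fiberAction (hB : IsBSite J) (hG : IsGrid J ι₀) (F : Cᵒᵖ ⥤ Type w) :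
    Action (Type w) (GaloisMonoid ι₀) where
  V := fiber J ι₀ F
  ρ :=
    { toFun := fun a => act hB hG F a
      map_one' := by
        show act hB hG F 1 = 𝟙 _
        rw [act_eq, actAll_one, Category.id_comp, Iso.hom_inv_id]
      map_mul' := fun a b => by
        show act hB hG F (a * b) = act hB hG F b ≫ act hB hG F a
        simp only [act_eq, actAll_mul, Category.assoc, Iso.inv_hom_id_assoc] }

theorem fiberAction_smooth (hB : IsBSite J) (hG : IsGrid J ι₀) (F : Cᵒᵖ ⥤ Type w) :
    IsSmooth J ι₀ (fiberAction hB hG F) := by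
  intro s
  obtain ⟨X, x, rfl⟩ := Types.jointly_surjective' s
  refine ⟨X.unop.obj, X.unop.property, ?_⟩
  rintro a ⟨h, h'⟩
  have key : ∀ (Y : C₀) (hY : X.unop.obj = Y) (q : ι₀.obj Y ⟶ ι₀.obj X.unop.obj),
      q = eqToHom (congrArg ι₀.obj hY.symm) →
      F.map q.op ≫ colimit.ι (ι₀.op ⋙ F) (op Y) = colimit.ι (ι₀.op ⋙ F) (op X.unop.obj) := by
    rintro Y rfl q rfl
    exact (congrArg (· ≫ colimit.ι (ι₀.op ⋙ F) (op X.unop.obj))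
      (F.map_id (op (ι₀.obj X.unop.obj)))).trans (Category.id_comp _)
  have hq : a.γ.inv.app X.unop.obj = eqToHom (congrArg ι₀.obj h) := by
    have hi := Iso.hom_inv_id_app a.γ X.unop.obj
    rw [h'] at hi
    have hi' := congrArg (eqToHom (congrArg ι₀.obj h) ≫ ·) hi
    simp only [eqToHom_trans_assoc, eqToHom_refl, Category.id_comp] at hi'
    exact hi'.trans (Category.comp_id _)
  have e : colimit.ι ((IsEdge J ι₀).ι.op ⋙ ι₀.op ⋙ F) X ≫ act hB hG F a =
      colimit.ι ((IsEdge J ι₀).ι.op ⋙ ι₀.op ⋙ F) X := by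
    refine (ι_act hB hG F a X.unop).trans ?_
    rw [← Category.assoc]
    refine (congrArg (· ≫ (fiberIso hB hG F).inv) (key _ h.symm _ hq)).trans ?_
    rw [Iso.comp_inv_eq]
    exact (ι_fiberIso_hom hB hG F X.unop).symm
  exact ConcreteCategory.congr_hom e x

/-- The map `ω(F) → ω(F')` induced by a morphism of presheaves. -/
noncomputable def fiberMap (J : GrothendieckTopology C) (ι₀ : C₀ ⥤ C) {F F' : Cᵒᵖ ⥤ Type w}
    (t : F ⟶ F') : fiber J ι₀ F ⟶ fiber J ι₀ F' :=
  colimMap (Functor.whiskerLeft (IsEdge J ι₀).ι.op (Functor.whiskerLeft ι₀.op t))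

theorem ι_fiberMap (J : GrothendieckTopology C) (ι₀ : C₀ ⥤ C) {F F' : Cᵒᵖ ⥤ Type w}
    (t : F ⟶ F') (X : (IsEdge J ι₀).FullSubcategory) :
    colimit.ι ((IsEdge J ι₀).ι.op ⋙ ι₀.op ⋙ F) (op X) ≫ fiberMap J ι₀ t =
      t.app (op (ι₀.obj X.obj)) ≫ colimit.ι ((IsEdge J ι₀).ι.op ⋙ ι₀.op ⋙ F') (op X) :=
  ι_colimMap _ _

theorem fiberMap_act (hB : IsBSite J) (hG : IsGrid J ι₀) {F F' : Cᵒᵖ ⥤ Type w} (t : F ⟶ F')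
    (a : GaloisMonoid ι₀) :
    act hB hG F a ≫ fiberMap J ι₀ t = fiberMap J ι₀ t ≫ act hB hG F' a := by
  have hall : (fiberIso hB hG F).inv ≫ fiberMap J ι₀ t =
      colimMap (Functor.whiskerLeft ι₀.op t) ≫ (fiberIso hB hG F').inv := by
    rw [Iso.inv_comp_eq, ← Category.assoc, Iso.eq_comp_inv]
    refine colimit.hom_ext fun X => ?_
    have h₁ := congrArg (· ≫ colimMap (Functor.whiskerLeft ι₀.op t))
      (ι_fiberIso_hom hB hG F X.unop)
    simp only [Category.assoc, ι_colimMap] at h₁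
    refine Eq.trans ?_ h₁.symm
    unfold fiberMap
    rw [ι_colimMap_assoc]
    exact congrArg (t.app (op (ι₀.obj X.unop.obj)) ≫ ·) (ι_fiberIso_hom hB hG F' X.unop)
  refine colimit.hom_ext fun X => ?_
  have h₁ := congrArg (· ≫ fiberMap J ι₀ t) (ι_act hB hG F a X.unop)
  simp only [Category.assoc, hall] at h₁
  rw [ι_colimMap_assoc] at h₁
  refine h₁.trans ?_
  unfold fiberMap
  rw [ι_colimMap_assoc]
  refine Eq.trans ?_
    (congrArg (t.app (op (ι₀.obj X.unop.obj)) ≫ ·) (ι_act hB hG F' a X.unop)).symm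
  have hn := t.naturality (a.γ.inv.app X.unop.obj).op
  have hn' := congrArg (· ≫ colimit.ι (ι₀.op ⋙ F') (op (a.α.obj X.unop.obj)) ≫
    (fiberIso hB hG F').inv) hn
  simp only [Category.assoc] at hn'
  exact hn'

/-- The fiber functor on presheaves, with values in smooth sets. -/
noncomputable def presheafFiberFunctor (hB : IsBSite J) (hG : IsGrid J ι₀) :
    (Cᵒᵖ ⥤ Type w) ⥤ SmoothSet J ι₀ where
  obj F := ⟨fiberAction hB hG F, fiberAction_smooth hB hG F⟩
  map t := ObjectProperty.homMk ⟨fiberMap J ι₀ t, fun a => fiberMap_act hB hG t a⟩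
  map_id F := by
    refine ObjectProperty.hom_ext _ (Action.hom_ext _ _ ?_)
    refine colimit.hom_ext fun X => ?_
    exact (ι_colimMap _ _).trans ((Category.id_comp _).trans (Category.comp_id _).symm)
  map_comp t t' := by
    refine ObjectProperty.hom_ext _ (Action.hom_ext _ _ ?_)
    refine colimit.hom_ext fun X => ?_
    have h := congrArg (· ≫ fiberMap J ι₀ t') (ι_fiberMap J ι₀ t X.unop)
    simp only [Category.assoc] at h
    refine (ι_fiberMap J ι₀ (t ≫ t') X.unop).trans (Eq.trans ?_ h.symm)
    refine Eq.trans ?_ (congrArg (t.app _ ≫ ·) (ι_fiberMap J ι₀ t' X.unop)).symm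
    exact Category.assoc _ _ _

/-- The fiber functor `ω` from sheaves of sets on `(C, J)` to smooth sets. -/
noncomputable def fiberFunctor (hY : IsYSite.{w} J) (hG : IsGrid J ι₀) :
    Sheaf J (Type w) ⥤ SmoothSet J ι₀ :=
  sheafToPresheaf J (Type w) ⋙ presheafFiberFunctor hY.toIsBSite hG

end FiberFunctor

end YSites

/-! A point of `X` is an object `Z` of the grid with an isomorphism of `X` with `ι₀ Z`; the grid
axioms make this the same as a morphism to `X` from the pro-object that the grid defines. So points
push forward functorially, any two come from a common point, and a morphism is determined by what it
does to one point. The monoid `M` acts on the points of each object and commutes with push-forward.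
Conversely a compatible family of points, one for each `ι₀ Z`, is an element of `M`. Points lift
along the morphisms in `T(J)`, and the automorphisms of a Galois covering permute transitively the
points above a given one.

A section `x` over `X` has a germ in `ω(F)` at every point of `X`. For a sheaf, taking germs at an
edge point is injective, because restriction along `T(J)` is (`germ_injective`). This gives
faithfulness without any cardinality condition.

For the equivalence, `M` must move an edge point to any other point of the same object
(`exists_smul_eq`). Such an element is a point of an inverse limit of nonempty sets, and the two
conditions are the standard reasons for that limit to be nonempty: finite sets, or a countable
system with surjective transition maps. Since `M` need not be a group, orbit-stabilizer arguments
also need that two elements agreeing at an edge point differ on the right by an element of its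
stabilizer (`exists_eq_mul_of_smul_eq`). This holds unconditionally, because there the choices are
forced.

Galois descent then identifies `F(X)` with the elements of `ω(F)` fixed by the stabilizer of an edge
point of `X` (`exists_germ_eq_of_fixed`), which gives fullness. A smooth set `S` is the fiber of the
sheaf that sends `X` to the elements of `S` fixed by the stabilizer of an edge point of `X`
(`fixedPresheaf_isSheaf`). -/

namespace YSites

/-! ### Coverings in a `Y`-site and descent along normal morphisms. -/

section Site

variable {C : Type u} [Category.{v} C] {J : GrothendieckTopology C}

theorem coverMor_of_isIso (hB : IsBSite J) {X Y : C} (f : Y ⟶ X) [IsIso f] : coverMor J f := by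
  have h : coverMor J (f ≫ inv f) := by
    rw [IsIso.hom_inv_id]
    exact (coverMor_isMultiplicative J).id_mem Y
  exact ((hB.comp_iff _ _).1 h).2

theorem coverMor_comp {X Y Z : C} {g : Z ⟶ Y} {f : Y ⟶ X} (hg : coverMor J g)
    (hf : coverMor J f) : coverMor J (g ≫ f) :=
  (coverMor_isMultiplicative J).comp_mem g f hg hf

theorem coverMor_of_comp_right (hB : IsBSite J) {X Y Z : C} {g : Z ⟶ Y} {f : Y ⟶ X}
    (h : coverMor J (g ≫ f)) : coverMor J g :=
  ((hB.comp_iff _ _).1 h).2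

/-- A member of the semi-localizing collection generates a sieve that contains it, hence a covering
one. So `T(J)` itself can be used to test coverings. -/
theorem exists_coverMor_of_mem (hB : IsBSite J) {X : C} {R : Sieve X} (hR : R ∈ J X) :
    ∃ (Y : C) (f : Y ⟶ X), R f ∧ coverMor J f := by
  obtain ⟨T, -, hJ⟩ := hB.isATopology
  obtain ⟨Y, f, hf, hT⟩ := (hJ X R).1 hR
  exact ⟨Y, f, hf, (hJ X _).2 ⟨Y, f, Sieve.le_generate _ _ _ Presieve.singleton.mk, hT⟩⟩

/-- The right Ore condition for `T(J)`. -/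
theorem coverMor_ore (hB : IsBSite J) {X Y Z : C} {f : Y ⟶ X} (hf : coverMor J f) (h : Z ⟶ X) :
    ∃ (W : C) (l : W ⟶ Y) (k : W ⟶ Z), coverMor J k ∧ l ≫ f = k ≫ h := by
  obtain ⟨W, k, hk, hk'⟩ := exists_coverMor_of_mem hB (J.pullback_stable h hf)
  obtain ⟨_, l, _, ⟨⟩, e⟩ := hk
  exact ⟨W, l, k, hk', e⟩

/-- The automorphisms of `Y` over `X` act transitively on the fibers of
`Hom(Z, Y) → Hom(Z, X)` for every `Z`. -/
def IsNormal {X Y : C} (f : Y ⟶ X) : Prop :=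
  ∀ (Z : C) (h h' : Z ⟶ Y), h ≫ f = h' ≫ f → ∃ g : Y ≅ Y, g.hom ≫ f = f ∧ h ≫ g.hom = h'

theorem IsGaloisCovering.isNormal {X Y : C} {f : Y ⟶ X} (hf : IsGaloisCovering f) :
    IsNormal f := by
  intro Z h h' e
  obtain ⟨G, _, ρ, hρ⟩ := hf
  let := homAction ρ Z
  obtain ⟨g, hg⟩ := (hρ Z).injective h h' e
  exact ⟨(Over.forget X).mapIso (ρ g), Over.w (ρ g).hom, hg⟩

theorem IsNormal.iso_comp {X Y Y' : C} {f : Y ⟶ X} (hf : IsNormal f) (a : Y' ≅ Y) :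
    IsNormal (a.hom ≫ f) := by
  intro Z h h' e
  obtain ⟨g, hg, hg'⟩ := hf Z (h ≫ a.hom) (h' ≫ a.hom) (by simpa using e)
  refine ⟨a ≪≫ g ≪≫ a.symm, by simp [hg], ?_⟩
  simp only [Iso.trans_hom, Iso.symm_hom]
  rw [← Category.assoc, ← Category.assoc, hg', Category.assoc, Iso.hom_inv_id, Category.comp_id]

theorem IsYSite.exists_normal (hY : IsYSite.{w} J) {X Y : C} {f : Y ⟶ X} (hf : coverMor J f) :
    ∃ (Z : C) (g : Z ⟶ Y), coverMor J (g ≫ f) ∧ IsNormal (g ≫ f) := by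
  have h : hat (coverMor J) f := ⟨Y, 𝟙 Y, by simpa using hf⟩
  rw [← hY.enoughGalois] at h
  obtain ⟨Z, g, hg, hg'⟩ := h
  exact ⟨Z, g, hg, hg'.isNormal⟩

theorem map_injective_of_isSheaf {F : Cᵒᵖ ⥤ Type w} (hF : Presieve.IsSheaf J F) {X Y : C}
    {f : Y ⟶ X} (hf : coverMor J f) : Function.Injective (F.map f.op) :=
  Presieve.isSeparatedFor_singleton.1
    ((Presieve.isSheafFor_iff_generate _).2 (hF _ hf)).isSeparatedFor

/-- Two morphisms to `Y` that agree over `X` differ by an automorphism, so invariance under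
automorphisms is the whole compatibility condition, even when fiber products do not exist. -/
theorem exists_map_eq_of_isSheaf {F : Cᵒᵖ ⥤ Type w} (hF : Presieve.IsSheaf J F) {X Y : C}
    {f : Y ⟶ X} (hf : coverMor J f) (hf' : IsNormal f) (y : F.obj (op Y))
    (hy : ∀ g : Y ≅ Y, g.hom ≫ f = f → F.map g.hom.op y = y) :
    ∃ x, F.map f.op x = y := by
  obtain ⟨x, hx, -⟩ := Presieve.isSheafFor_singleton.1
    ((Presieve.isSheafFor_iff_generate _).2 (hF _ hf)) y (fun {Z} h h' e => by
      obtain ⟨g, hg, rfl⟩ := hf' _ _ _ e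
      rw [op_comp, F.map_comp, types_comp_apply, hy g hg])
  exact ⟨x, hx⟩

/-- A presheaf is a sheaf as soon as it is separated and sections invariant under the
automorphisms of a normal covering descend. -/
theorem isSheaf_of_normal (hY : IsYSite.{w} J) (F : Cᵒᵖ ⥤ Type w)
    (hinj : ∀ {X Y : C} (f : Y ⟶ X), coverMor J f → Function.Injective (F.map f.op))
    (hdesc : ∀ {X Y : C} (f : Y ⟶ X), coverMor J f → IsNormal f → ∀ y : F.obj (op Y),
      (∀ g : Y ≅ Y, g.hom ≫ f = f → F.map g.hom.op y = y) → ∃ x, F.map f.op x = y) :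
    Presieve.IsSheaf J F := by
  intro X R hR
  obtain ⟨Y₀, f₀, hf₀, hT₀⟩ := exists_coverMor_of_mem hY.toIsBSite hR
  obtain ⟨Y, g, hT, hgal⟩ := hY.exists_normal hT₀
  have hf : R (g ≫ f₀) := R.downward_closed hf₀ g
  generalize g ≫ f₀ = f at hT hgal hf
  intro x hx
  obtain ⟨t, ht⟩ := hdesc f hT hgal (x f hf) (fun g hg => by
    have := hx g.hom (𝟙 _) hf hf (by simpa using hg)
    simpa using this)
  refine ⟨t, ?_, ?_⟩
  · intro Z h hh
    -- On the Ore square over `f` and `h`, both candidates restrict to the same section over `W`,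
    -- and restriction along `k` is injective.
    obtain ⟨W, l, k, hk, e⟩ := coverMor_ore hY.toIsBSite hT h
    apply hinj k hk
    have h₁ := hx l k hf hh e
    rw [← h₁, ← ht, ← types_comp_apply (F.map h.op), ← F.map_comp, ← op_comp, ← e, op_comp,
      F.map_comp, types_comp_apply]
  · intro t' ht'
    apply hinj f hT
    rw [ht, ht' f hf]

end Site

/-! ### Points of objects, their push-forward and the monoid action. -/

section Points

variable {C : Type u} [Category.{v} C] {C₀ : Type w} [PartialOrder C₀]

/-- A point of `X`: an object of the grid together with an isomorphism from `X` to its image.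
Points of `X` are the same as morphisms to `X` from the pro-object defined by the grid. -/
structure Point (ι₀ : C₀ ⥤ C) (X : C) where
  /-- the underlying object of the grid -/
  base : C₀
  /-- the isomorphism with the image of the underlying object -/
  iso : X ≅ ι₀.obj base

variable {ι₀ : C₀ ⥤ C}

namespace Point

/-- The tautological point of `ι₀ Z`. -/
def std (ι₀ : C₀ ⥤ C) (Z : C₀) : Point ι₀ (ι₀.obj Z) := ⟨Z, Iso.refl _⟩

/-- The point `q` of `Y` is the image of the point `p` of `X` under `f : X ⟶ Y`. -/
def Lies {X Y : C} (f : X ⟶ Y) (p : Point ι₀ X) (q : Point ι₀ Y) : Prop :=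
  ∃ h : p.base ⟶ q.base, f ≫ q.iso.hom = p.iso.hom ≫ ι₀.map h

instance (X : C) : MulAction (GaloisMonoid ι₀) (Point ι₀ X) where
  smul m p := ⟨m.α.obj p.base, p.iso ≪≫ m.γ.app p.base⟩
  one_smul p := by
    obtain ⟨Z, a⟩ := p
    exact congrArg (Point.mk Z) (Iso.ext (Category.comp_id a.hom))
  mul_smul m n p := by
    obtain ⟨Z, a⟩ := p
    refine congrArg (Point.mk (m.α.obj (n.α.obj Z))) (Iso.ext ?_)
    show a.hom ≫ (m * n).γ.hom.app Z = (a.hom ≫ n.γ.hom.app Z) ≫ m.γ.hom.app (n.α.obj Z)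
    rw [GaloisMonoid.mul_γ_hom_app, Category.assoc]

theorem smul_iso_hom {X : C} (m : GaloisMonoid ι₀) (p : Point ι₀ X) :
    (m • p).iso.hom = p.iso.hom ≫ m.γ.hom.app p.base := rfl

theorem smul_iso_inv {X : C} (m : GaloisMonoid ι₀) (p : Point ι₀ X) :
    (m • p).iso.inv = m.γ.inv.app p.base ≫ p.iso.inv := rfl

theorem Lies.smul {X Y : C} {f : X ⟶ Y} {p : Point ι₀ X} {q : Point ι₀ Y} (h : Lies f p q)
    (m : GaloisMonoid ι₀) : Lies f (m • p) (m • q) := by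
  obtain ⟨h, e⟩ := h
  refine ⟨m.α.map h, ?_⟩
  rw [smul_iso_hom, smul_iso_hom, ← Category.assoc, e, Category.assoc, Category.assoc]
  exact congrArg (p.iso.hom ≫ ·) (m.γ.hom.naturality h)

theorem Lies.comp {X Y Z : C} {f : X ⟶ Y} {g : Y ⟶ Z} {p : Point ι₀ X} {q : Point ι₀ Y}
    {r : Point ι₀ Z} (h : Lies f p q) (h' : Lies g q r) : Lies (f ≫ g) p r := by
  obtain ⟨h, e⟩ := h
  obtain ⟨h', e'⟩ := h'
  exact ⟨h ≫ h', by rw [Category.assoc, e', ← Category.assoc, e, ι₀.map_comp, Category.assoc]⟩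

theorem Lies.id {X : C} (p : Point ι₀ X) : Lies (𝟙 X) p p :=
  ⟨𝟙 _, by simp⟩

theorem Lies.std {Z V : C₀} (h : Z ⟶ V) : Lies (ι₀.map h) (std ι₀ Z) (std ι₀ V) :=
  ⟨h, by simp [Point.std]⟩

theorem Lies.std_inv {X : C} (p : Point ι₀ X) : Lies p.iso.inv (Point.std ι₀ p.base) p :=
  ⟨𝟙 _, by simp [Point.std]⟩

/-- A morphism is determined by a point of its source and the image of that point. -/
theorem Lies.hom_unique {X Y : C} {f f' : X ⟶ Y} {p : Point ι₀ X} {q : Point ι₀ Y}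
    (h : Lies f p q) (h' : Lies f' p q) : f = f' := by
  obtain ⟨h, e⟩ := h
  obtain ⟨h', e'⟩ := h'
  rw [← cancel_mono q.iso.hom, e, e', Subsingleton.elim h h']

variable {J : GrothendieckTopology C}

/-- Fullness of the functor on undercategories of `U`. This is what forces images of points to be
unique. -/
theorem exists_hom_of_under (hG : IsGrid J ι₀) {U Z V : C₀} (h : U ⟶ Z) (h' : U ⟶ V)
    (k : ι₀.obj Z ⟶ ι₀.obj V) (e : ι₀.map h ≫ k = ι₀.map h') :
    ∃ l : Z ⟶ V, ι₀.map l = k := by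
  have := hG.under_equivalence U
  let φ : (Under.post ι₀).obj (Under.mk h) ⟶ (Under.post ι₀).obj (Under.mk h') := Under.homMk k e
  refine ⟨((Under.post ι₀).preimage φ).right, ?_⟩
  exact congrArg CommaMorphism.right ((Under.post ι₀).map_preimage φ)

theorem eq_of_hom (hG : IsGrid J ι₀) {X : C} {p q : Point ι₀ X} (l : p.base ⟶ q.base)
    (e : p.iso.hom ≫ ι₀.map l = q.iso.hom) : p = q := by
  obtain ⟨Z, a⟩ := p
  obtain ⟨V, b⟩ := q
  dsimp only at l e
  -- The image of `l` is invertible and its inverse also lifts, so antisymmetry of the poset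
  -- identifies the two bases.
  obtain ⟨l', -⟩ := exists_hom_of_under hG l (𝟙 Z) (b.inv ≫ a.hom) (by
    rw [← cancel_epi a.hom, ← Category.assoc, e]
    simp)
  obtain rfl : Z = V := le_antisymm (leOfHom l) (leOfHom l')
  obtain rfl : l = 𝟙 Z := Subsingleton.elim _ _
  refine congrArg (Point.mk Z) (Iso.ext ?_)
  simpa using e

theorem Lies.unique (hG : IsGrid J ι₀) {X Y : C} {f : X ⟶ Y} {p : Point ι₀ X} {q q' : Point ι₀ Y}
    (h : Lies f p q) (h' : Lies f p q') : q = q' := by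
  obtain ⟨h, e⟩ := h
  obtain ⟨h', e'⟩ := h'
  obtain ⟨l, hl⟩ := exists_hom_of_under hG h h' (q.iso.inv ≫ q'.iso.hom) (by
    rw [← cancel_epi p.iso.hom, ← e', ← Category.assoc, ← e]
    simp)
  exact eq_of_hom hG l (by simp [hl])

/-- Essential surjectivity on the undercategory of the base of `p`, applied to `f` transported to
`ι₀ p.base`. -/
theorem exists_lies (hG : IsGrid J ι₀) {X Y : C} (f : X ⟶ Y) (p : Point ι₀ X) :
    ∃ q : Point ι₀ Y, Lies f p q := by
  have := hG.under_equivalence p.base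
  let Φ : Under p.base ⥤ Under (ι₀.obj p.base) := Under.post ι₀
  let A : Under (ι₀.obj p.base) := Under.mk (p.iso.inv ≫ f)
  let V : Under p.base := Φ.objPreimage A
  let i : Φ.obj V ≅ A := Φ.objObjPreimageIso A
  have hi : ι₀.map V.hom ≫ i.hom.right = p.iso.inv ≫ f := Under.w i.hom
  let j : Y ≅ ι₀.obj V.right := (Under.forget _).mapIso i.symm
  have hj : ι₀.map V.hom ≫ j.inv = p.iso.inv ≫ f := hi
  refine ⟨⟨V.right, j⟩, V.hom, ?_⟩
  rw [← Iso.inv_comp_eq, ← Category.assoc, ← hj, Category.assoc, Iso.inv_hom_id, Category.comp_id]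

/-- The image of a point under a morphism. -/
noncomputable def push (hG : IsGrid J ι₀) {X Y : C} (f : X ⟶ Y) (p : Point ι₀ X) : Point ι₀ Y :=
  (exists_lies hG f p).choose

theorem lies_push (hG : IsGrid J ι₀) {X Y : C} (f : X ⟶ Y) (p : Point ι₀ X) :
    Lies f p (push hG f p) :=
  (exists_lies hG f p).choose_spec

theorem Lies.push_eq (hG : IsGrid J ι₀) {X Y : C} {f : X ⟶ Y} {p : Point ι₀ X} {q : Point ι₀ Y}
    (h : Lies f p q) : push hG f p = q :=
  (lies_push hG f p).unique hG h

theorem push_id (hG : IsGrid J ι₀) {X : C} (p : Point ι₀ X) : push hG (𝟙 X) p = p :=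
  (Lies.id p).push_eq hG

theorem push_comp (hG : IsGrid J ι₀) {X Y Z : C} (f : X ⟶ Y) (g : Y ⟶ Z) (p : Point ι₀ X) :
    push hG (f ≫ g) p = push hG g (push hG f p) :=
  ((lies_push hG f p).comp (lies_push hG g _)).push_eq hG

theorem smul_push (hG : IsGrid J ι₀) {X Y : C} (f : X ⟶ Y) (m : GaloisMonoid ι₀)
    (p : Point ι₀ X) : m • push hG f p = push hG f (m • p) :=
  (((lies_push hG f p).smul m).push_eq hG).symm

theorem push_std (hG : IsGrid J ι₀) {Z V : C₀} (h : Z ⟶ V) :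
    push hG (ι₀.map h) (std ι₀ Z) = std ι₀ V :=
  (Lies.std h).push_eq hG

theorem push_iso_inv (hG : IsGrid J ι₀) {X : C} (p : Point ι₀ X) :
    push hG p.iso.inv (std ι₀ p.base) = p :=
  (Lies.std_inv p).push_eq hG

theorem push_injective_hom (hG : IsGrid J ι₀) {X Y : C} {f f' : X ⟶ Y} (p : Point ι₀ X)
    (h : push hG f p = push hG f' p) : f = f' := by
  have h₁ := lies_push hG f p
  rw [h] at h₁
  exact h₁.hom_unique (lies_push hG f' p)

theorem push_map_comp (hG : IsGrid J ι₀) {U V W : C₀} (h : U ⟶ V) (k : V ⟶ W) (l : U ⟶ W)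
    (p : Point ι₀ (ι₀.obj U)) :
    push hG (ι₀.map k) (push hG (ι₀.map h) p) = push hG (ι₀.map l) p := by
  rw [← push_comp, ← ι₀.map_comp, Subsingleton.elim (h ≫ k) l]

/-- Any two points are images of a common point. -/
theorem exists_common (hG : IsGrid J ι₀) {X Y : C} (p : Point ι₀ X) (q : Point ι₀ Y) :
    ∃ (U : C₀) (u : ι₀.obj U ⟶ X) (u' : ι₀.obj U ⟶ Y) (_ : U ⟶ p.base) (_ : U ⟶ q.base),
      push hG u (std ι₀ U) = p ∧ push hG u' (std ι₀ U) = q := by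
  obtain ⟨U, ⟨h⟩, ⟨h'⟩⟩ := hG.lambdaConnected p.base q.base
  refine ⟨U, ι₀.map h ≫ p.iso.inv, ι₀.map h' ≫ q.iso.inv, h, h', ?_, ?_⟩
  · rw [push_comp, push_std, push_iso_inv]
  · rw [push_comp, push_std, push_iso_inv]

/-- Points lift along the morphisms in `T(J)`. -/
theorem exists_push_eq (hB : IsBSite J) (hG : IsGrid J ι₀) {X Y : C} {f : Y ⟶ X}
    (hf : coverMor J f) (p : Point ι₀ X) :
    ∃ r : Point ι₀ Y, push hG f r = p := by
  obtain ⟨Z, h, a, e⟩ := hG.exists_lift p.base (f ≫ p.iso.hom)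
    (coverMor_comp hf (coverMor_of_isIso hB _))
  exact ⟨⟨Z, a⟩, Lies.push_eq hG ⟨h, e⟩⟩

/-- The automorphisms of a normal covering act transitively on the points above a given point. -/
theorem exists_iso_push_eq (hG : IsGrid J ι₀) {X Y : C} {f : Y ⟶ X} (hf : IsNormal f)
    {r r' : Point ι₀ Y} (h : push hG f r = push hG f r') :
    ∃ g : Y ≅ Y, g.hom ≫ f = f ∧ push hG g.hom r = r' := by
  -- Writing both points as images of one point turns equality of points above `X` into equality of
  -- morphisms to `X`, where normality applies.
  obtain ⟨U, u, u', -, -, rfl, rfl⟩ := exists_common hG r r'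
  rw [← push_comp, ← push_comp] at h
  obtain ⟨g, hg, hg'⟩ := hf _ _ _ (push_injective_hom hG _ h)
  exact ⟨g, hg, by rw [← push_comp, hg']⟩

/-- A point is an edge point if it lies on an edge object of the grid. -/
def Edge (J : GrothendieckTopology C) {X : C} (p : Point ι₀ X) : Prop := IsEdge J ι₀ p.base

theorem Edge.of_push (hB : IsBSite J) (hG : IsGrid J ι₀) {X Y : C} {f : Y ⟶ X} {r : Point ι₀ Y}
    (h : Edge J (push hG f r)) : Edge J r := by
  obtain ⟨k, -⟩ := lies_push hG f r
  exact edge_of_hom hB h k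

theorem exists_edge_point (hG : IsGrid J ι₀) (X : C) : ∃ p : Point ι₀ X, Edge J p := by
  obtain ⟨Z, hZ, ⟨i⟩⟩ := hG.exists_edge X
  exact ⟨⟨Z, i.symm⟩, hZ⟩

/-- The `eqToHom` condition defining `K_Z` is an equality of points, so from here on `K_Z` is an
honest stabilizer. -/
theorem mem_stab_iff (m : GaloisMonoid ι₀) (Z : C₀) :
    m ∈ stab ι₀ Z ↔ m • std ι₀ Z = std ι₀ Z := by
  have key : ∀ (V : C₀) (i : ι₀.obj Z ≅ ι₀.obj V),
      (∃ h : V = Z, i.hom = eqToHom (congrArg ι₀.obj h.symm)) ↔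
        (⟨V, i⟩ : Point ι₀ (ι₀.obj Z)) = std ι₀ Z := by
    intro V i
    constructor
    · rintro ⟨rfl, h⟩
      exact congrArg (Point.mk V) (Iso.ext h)
    · intro h
      obtain rfl : V = Z := congrArg Point.base h
      refine ⟨rfl, ?_⟩
      have : i = Iso.refl _ := by
        have := Point.mk.inj h
        exact eq_of_heq this.2
      rw [this]
      rfl
  refine (key _ (m.γ.app Z)).trans ?_
  have : (⟨m.α.obj Z, m.γ.app Z⟩ : Point ι₀ (ι₀.obj Z)) = m • std ι₀ Z :=
    congrArg (Point.mk _) (Iso.ext (Category.id_comp _).symm)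
  rw [this]

theorem smul_eq_self_iff (hG : IsGrid J ι₀) {X : C} (p : Point ι₀ X) (m : GaloisMonoid ι₀) :
    m • p = p ↔ m ∈ stab ι₀ p.base := by
  rw [mem_stab_iff]
  constructor
  · intro h
    have h' : push hG p.iso.hom p = std ι₀ p.base :=
      Lies.push_eq hG ⟨𝟙 _, by simp [std]⟩
    rw [← h', smul_push, h]
  · intro h
    rw [← push_iso_inv hG p, smul_push, h]

end Point

end Points

/-! ### Transitivity of the monoid on points, and stabilizers. -/

section Transitivity

variable {C : Type u} [Category.{v} C] {J : GrothendieckTopology C} {C₀ : Type w}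
  [PartialOrder C₀] {ι₀ : C₀ ⥤ C}

open Point

theorem GaloisMonoid.ext_of_smul {m m' : GaloisMonoid ι₀}
    (h : ∀ Z, m • std ι₀ Z = m' • std ι₀ Z) : m = m' := by
  obtain ⟨α, γ⟩ := m
  obtain ⟨α', γ'⟩ := m'
  obtain rfl : α = α' := CategoryTheory.Functor.ext (fun Z => congrArg Point.base (h Z))
    (fun _ _ _ => Subsingleton.elim _ _)
  refine mk_congr fun Z => ?_
  have h₁ : Iso.refl _ ≪≫ γ.app Z = Iso.refl _ ≪≫ γ'.app Z :=
    eq_of_heq (Point.mk.inj (h Z)).2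
  simpa using congrArg Iso.hom h₁

/-- A compatible family of points defines an element of the Galois monoid. -/
theorem exists_smul_std_eq_of_compatible (hG : IsGrid J ι₀)
    (σ : ∀ Z : C₀, Point ι₀ (ι₀.obj Z))
    (hσ : ∀ {Z V : C₀} (h : Z ⟶ V), push hG (ι₀.map h) (σ Z) = σ V) :
    ∃ m : GaloisMonoid ι₀, ∀ Z, m • std ι₀ Z = σ Z := by
  have hl : ∀ {Z V : C₀} (h : Z ⟶ V), Lies (ι₀.map h) (σ Z) (σ V) := fun h => by
    rw [← hσ h]
    exact lies_push hG _ _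
  let α : C₀ ⥤ C₀ :=
    { obj := fun Z => (σ Z).base
      map := fun h => (hl h).choose
      map_id := fun _ => Subsingleton.elim _ _
      map_comp := fun _ _ => Subsingleton.elim _ _ }
  let γ : ι₀ ≅ α ⋙ ι₀ := NatIso.ofComponents (fun Z => (σ Z).iso) (fun h => (hl h).choose_spec)
  refine ⟨⟨α, γ⟩, fun Z => ?_⟩
  exact congrArg (Point.mk (σ Z).base) (Iso.ext (Category.id_comp _))

/-- A compatible family of points on a cofinal family of objects of the grid defines an element
of the Galois monoid. -/
theorem exists_smul_std_eq_of_cofinal (hG : IsGrid J ι₀) {I : Type*} (W : I → C₀)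
    (σ : ∀ i, Point ι₀ (ι₀.obj (W i))) (hW : ∀ V, ∃ i, W i ≤ V)
    (hσ : ∀ i j, ∃ (k : I) (a : W k ⟶ W i) (b : W k ⟶ W j),
      push hG (ι₀.map a) (σ k) = σ i ∧ push hG (ι₀.map b) (σ k) = σ j) :
    ∃ m : GaloisMonoid ι₀, ∀ i, m • std ι₀ (W i) = σ i := by
  choose i hi using hW
  -- The family is extended to all of `C₀` by pushing forward from some index below `V`; `hσ` makes
  -- the result independent of that index.
  let τ : ∀ V : C₀, Point ι₀ (ι₀.obj V) := fun V => push hG (ι₀.map (homOfLE (hi V))) (σ (i V))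
  have hτ : ∀ (V : C₀) (j : I) (h : W j ⟶ V), push hG (ι₀.map h) (σ j) = τ V := by
    intro V j h
    obtain ⟨k, a, b, ha, hb⟩ := hσ (i V) j
    rw [← hb, push_map_comp hG b h (b ≫ h)]
    show _ = push hG _ (σ (i V))
    rw [← ha, push_map_comp hG a _ (b ≫ h)]
  obtain ⟨m, hm⟩ := exists_smul_std_eq_of_compatible hG τ (fun {Z V} h => by
    show push hG _ (push hG _ (σ (i Z))) = _
    rw [push_map_comp hG _ h (homOfLE (hi Z) ≫ h), hτ])
  refine ⟨m, fun j => ?_⟩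
  rw [hm, ← hτ (W j) j (𝟙 _), ι₀.map_id, push_id]

theorem exists_normal_le (hY : IsYSite.{w} J) (hG : IsGrid J ι₀) {Y : C₀} (hE : IsEdge J ι₀ Y)
    (V : C₀) : ∃ (W : C₀) (h : W ≤ Y), W ≤ V ∧ IsNormal (ι₀.map (homOfLE h)) := by
  obtain ⟨U, ⟨a⟩, ⟨b⟩⟩ := hG.lambdaConnected Y V
  obtain ⟨Z, g, hg, hn⟩ := hY.exists_normal (hE U a)
  obtain ⟨W, f, i, e⟩ := hG.exists_lift U g (coverMor_of_comp_right hY.toIsBSite hg)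
  refine ⟨W, leOfHom (f ≫ a), leOfHom (f ≫ b), ?_⟩
  have h := hn.iso_comp i.symm
  rw [e, Iso.symm_hom, Category.assoc, Iso.inv_hom_id_assoc, ← ι₀.map_comp] at h
  exact h

/-- Objects of the grid which are normal over `Y`. -/
abbrev NormalBelow (ι₀ : C₀ ⥤ C) (Y : C₀) : Type w :=
  {W : C₀ // ∃ h : W ≤ Y, IsNormal (ι₀.map (homOfLE h))}

theorem NormalBelow.exists_le_le (hY : IsYSite.{w} J) (hG : IsGrid J ι₀) {Y : C₀}
    (hE : IsEdge J ι₀ Y) (V V' : C₀) : ∃ W : NormalBelow ι₀ Y, W.1 ≤ V ∧ W.1 ≤ V' := by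
  obtain ⟨U, ⟨a⟩, ⟨b⟩⟩ := hG.lambdaConnected V V'
  obtain ⟨W, h, hW, hn⟩ := exists_normal_le hY hG hE U
  exact ⟨⟨W, h, hn⟩, hW.trans (leOfHom a), hW.trans (leOfHom b)⟩

/-- The points above `q` of the objects which are normal over `Y`. -/
noncomputable def pointsAbove (hG : IsGrid J ι₀) {Y : C₀} (q : Point ι₀ (ι₀.obj Y)) :
    NormalBelow ι₀ Y ⥤ Type (max v w) where
  obj W := {r : Point ι₀ (ι₀.obj W.1) // push hG (ι₀.map (homOfLE W.2.choose)) r = q}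
  map {W W'} f := ↾(fun r => ⟨push hG (ι₀.map (homOfLE (leOfHom f))) r.1, by
    rw [push_map_comp hG _ _ (homOfLE W.2.choose), r.2]⟩)
  map_id W := by
    ext r
    show push hG (ι₀.map (𝟙 W.1)) r.1 = r.1
    rw [ι₀.map_id, push_id]
  map_comp f g := by
    ext r
    exact (push_map_comp hG _ _ _ _).symm

/-- A cofiltered limit of nonempty finite sets is nonempty; a section of `pointsAbove` is a
compatible family on a cofinal set of objects. -/
theorem exists_smul_std_eq_of_homFinite (hY : IsYSite.{w} J) (hG : IsGrid J ι₀) {Y : C₀}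
    (hE : IsEdge J ι₀ Y) (q : Point ι₀ (ι₀.obj Y))
    (hfin : HomFinite (Over (⟨ι₀.obj Y⟩ : CoverCat J))) :
    ∃ m : GaloisMonoid ι₀, m • std ι₀ Y = q := by
  have : IsCodirectedOrder (NormalBelow ι₀ Y) :=
    ⟨fun V V' => NormalBelow.exists_le_le hY hG hE V.1 V'.1⟩
  have hne : ∀ W, Nonempty ((pointsAbove hG q).obj W) := fun W => by
    obtain ⟨r, hr⟩ := exists_push_eq hY.toIsBSite hG (hE W.1 (homOfLE W.2.choose)) q
    exact ⟨⟨r, hr⟩⟩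
  -- By normality the fiber is a single orbit of `r₀` under endomorphisms over `Y`, and those are
  -- finite in number.
  have hf : ∀ W, Finite ((pointsAbove hG q).obj W) := fun W => by
    obtain ⟨r₀, hr₀⟩ := hne W
    let f : (⟨ι₀.obj W.1⟩ : CoverCat J) ⟶ ⟨ι₀.obj Y⟩ := ⟨ι₀.map (homOfLE W.2.choose), hE _ _⟩
    have := hfin (Over.mk f) (Over.mk f)
    let φ : (Over.mk f ⟶ Over.mk f) → (pointsAbove hG q).obj W := fun h =>
      ⟨push hG h.left.hom r₀, by
        have e : h.left.hom ≫ ι₀.map (homOfLE W.2.choose) = ι₀.map (homOfLE W.2.choose) :=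
          congrArg InducedWideCategory.Hom.hom (Over.w h)
        rw [← push_comp, e, hr₀]⟩
    refine Finite.of_surjective φ ?_
    rintro ⟨r, hr⟩
    obtain ⟨g, hg, hg'⟩ := exists_iso_push_eq hG W.2.choose_spec (hr₀.trans hr.symm)
    refine ⟨Over.homMk ⟨g.hom, coverMor_of_isIso hY.toIsBSite _⟩
      (InducedWideCategory.Hom.ext hg), Subtype.ext hg'⟩
  obtain ⟨σ, hσ⟩ := nonempty_sections_of_finite_cofiltered_system (pointsAbove hG q)
  have hσ' : ∀ (W W' : NormalBelow ι₀ Y) (h : W.1 ≤ W'.1),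
      push hG (ι₀.map (homOfLE h)) (σ W).1 = (σ W').1 := fun W W' h =>
    congrArg Subtype.val (hσ (homOfLE h : W ⟶ W'))
  obtain ⟨m, hm⟩ := exists_smul_std_eq_of_cofinal hG (fun W : NormalBelow ι₀ Y => W.1)
    (fun W => (σ W).1)
    (fun V => by
      obtain ⟨W, hW, -⟩ := NormalBelow.exists_le_le hY hG hE V V
      exact ⟨W, hW⟩)
    (fun W W' => by
      obtain ⟨W'', h, h'⟩ := NormalBelow.exists_le_le hY hG hE W.1 W'.1
      exact ⟨W'', homOfLE h, homOfLE h', hσ' _ _ h, hσ' _ _ h'⟩)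
  obtain ⟨W, -, -⟩ := NormalBelow.exists_le_le hY hG hE Y Y
  refine ⟨m, ?_⟩
  rw [← push_std hG (homOfLE W.2.choose), smul_push, hm, (σ W).2]

/-- A countable cofinal subset of the objects of the grid. -/
theorem exists_cofinal_seq (hY : IsYSite.{w} J) (hG : IsGrid J ι₀) {Y : C₀}
    (hE : IsEdge J ι₀ Y) (hc : CountablyGenerated (Over (⟨ι₀.obj Y⟩ : CoverCat J))) :
    ∃ z : ℕ → C₀, ∀ V, ∃ n, z n ≤ V := by
  obtain ⟨S, hS, hgen⟩ := hc
  have hSne : S.Nonempty := by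
    obtain ⟨s, hs, -⟩ := hgen (Over.mk (𝟙 _))
    exact ⟨s, hs⟩
  obtain ⟨s, rfl⟩ := hS.exists_eq_range hSne
  have key : ∀ n, ∃ (Z : C) (g : Z ⟶ (s n).left.obj) (r : Point ι₀ Z),
      coverMor J g ∧ IsNormal (g ≫ (s n).hom.hom) ∧
        push hG (g ≫ (s n).hom.hom) r = std ι₀ Y := fun n => by
    obtain ⟨Z, g, hg, hn⟩ := hY.exists_normal (s n).hom.property
    obtain ⟨r, hr⟩ := exists_push_eq hY.toIsBSite hG hg (std ι₀ Y)
    exact ⟨Z, g, r, coverMor_of_comp_right hY.toIsBSite hg, hn, hr⟩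
  choose Z g r hg hn hr using key
  refine ⟨fun n => (r n).base, fun V' => ?_⟩
  obtain ⟨V, ⟨a⟩, ⟨b⟩⟩ := hG.lambdaConnected Y V'
  let f : (⟨ι₀.obj V⟩ : CoverCat J) ⟶ ⟨ι₀.obj Y⟩ := ⟨ι₀.map a, hE _ _⟩
  obtain ⟨_, ⟨n, rfl⟩, ⟨h⟩⟩ := hgen (Over.mk f)
  have e : h.left.hom ≫ ι₀.map a = (s n).hom.hom :=
    congrArg InducedWideCategory.Hom.hom (Over.w h)
  obtain ⟨r', hr'⟩ := exists_push_eq hY.toIsBSite hG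
    (coverMor_comp (hg n) h.left.property) (std ι₀ V)
  have h₁ : push hG (g n ≫ (s n).hom.hom) (r n) = push hG (g n ≫ (s n).hom.hom) r' := by
    rw [hr, ← e, ← Category.assoc, push_comp, hr', push_std]
  obtain ⟨i, -, hi⟩ := exists_iso_push_eq hG (hn n) h₁
  rw [← hi, ← push_comp] at hr'
  -- One point `r n` for each `n` is enough: an automorphism takes it to a point above `V`, so `r n`
  -- itself maps to the tautological point of `V`, and its base is below `V`.
  have h₂ := lies_push hG (i.hom ≫ g n ≫ h.left.hom) (r n)
  rw [hr'] at h₂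
  obtain ⟨c, -⟩ := h₂
  exact ⟨n, leOfHom (c ≫ b)⟩

/-- With a cofinal sequence `z`, lifts of `q` are chosen recursively along a descending chain of
edge objects; stage `n + 1` lies below `z n`. -/
theorem exists_smul_std_eq_of_countablyGenerated (hY : IsYSite.{w} J) (hG : IsGrid J ι₀) {Y : C₀}
    (hE : IsEdge J ι₀ Y) (q : Point ι₀ (ι₀.obj Y))
    (hc : CountablyGenerated (Over (⟨ι₀.obj Y⟩ : CoverCat J))) :
    ∃ m : GaloisMonoid ι₀, m • std ι₀ Y = q := by
  obtain ⟨z, hz⟩ := exists_cofinal_seq hY hG hE hc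
  have step : ∀ (n : ℕ) (x : Σ V : {V : C₀ // IsEdge J ι₀ V}, Point ι₀ (ι₀.obj V.1)),
      ∃ (y : Σ V : {V : C₀ // IsEdge J ι₀ V}, Point ι₀ (ι₀.obj V.1)) (h : y.1.1 ⟶ x.1.1),
        y.1.1 ≤ z n ∧ push hG (ι₀.map h) y.2 = x.2 := by
    rintro n ⟨⟨V, hV⟩, p⟩
    obtain ⟨U, ⟨a⟩, ⟨b⟩⟩ := hG.lambdaConnected V (z n)
    obtain ⟨r, hr⟩ := exists_push_eq hY.toIsBSite hG (hV U a) p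
    exact ⟨⟨⟨U, edge_of_hom hY.toIsBSite hV a⟩, r⟩, a, leOfHom b, hr⟩
  choose next hom hle hpush using step
  let x : ℕ → Σ V : {V : C₀ // IsEdge J ι₀ V}, Point ι₀ (ι₀.obj V.1) :=
    fun n => Nat.rec ⟨⟨Y, hE⟩, q⟩ next n
  have hx : ∀ i j, i ≤ j → ∃ h : (x j).1.1 ⟶ (x i).1.1,
      push hG (ι₀.map h) (x j).2 = (x i).2 := by
    intro i j hij
    induction j, hij using Nat.le_induction with
    | base => exact ⟨𝟙 _, by rw [ι₀.map_id, push_id]⟩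
    | succ j _ ih =>
      obtain ⟨h, e⟩ := ih
      exact ⟨hom j (x j) ≫ h, by
        rw [← e, ← hpush j (x j), push_map_comp hG _ h (hom j (x j) ≫ h)]⟩
  obtain ⟨m, hm⟩ := exists_smul_std_eq_of_cofinal hG (fun n => (x n).1.1) (fun n => (x n).2)
    (fun V => by
      obtain ⟨n, hn⟩ := hz V
      exact ⟨n + 1, (hle n (x n)).trans hn⟩)
    (fun i j => by
      obtain ⟨a, ha⟩ := hx i (max i j) (le_max_left _ _)
      obtain ⟨b, hb⟩ := hx j (max i j) (le_max_right _ _)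
      exact ⟨_, a, b, ha, hb⟩)
  exact ⟨m, hm 0⟩

/-- The Galois monoid acts transitively on points, starting from any edge point. -/
theorem exists_smul_eq (hY : IsYSite.{w} J) (hG : IsGrid J ι₀)
    (hcard : ∀ X : CoverCat J, HomFinite (Over X) ∨ CountablyGenerated (Over X))
    {X : C} {p : Point ι₀ X} (hp : Edge J p) (q : Point ι₀ X) :
    ∃ m : GaloisMonoid ι₀, m • p = q := by
  obtain ⟨m, hm⟩ : ∃ m : GaloisMonoid ι₀, m • std ι₀ p.base = push hG p.iso.hom q := by
    rcases hcard ⟨ι₀.obj p.base⟩ with h | h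
    · exact exists_smul_std_eq_of_homFinite hY hG hp _ h
    · exact exists_smul_std_eq_of_countablyGenerated hY hG hp _ h
  refine ⟨m, ?_⟩
  rw [← push_iso_inv hG p, smul_push, hm, ← push_comp, Iso.hom_inv_id, push_id]

/-- Two elements of the Galois monoid with the same value at an edge point differ by right
multiplication by an element of the stabilizer of that point. -/
theorem exists_eq_mul_of_smul_std_eq (hY : IsYSite.{w} J) (hG : IsGrid J ι₀) {Y : C₀}
    (hE : IsEdge J ι₀ Y) {m m' : GaloisMonoid ι₀} (h : m • std ι₀ Y = m' • std ι₀ Y) :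
    ∃ k : GaloisMonoid ι₀, k • std ι₀ Y = std ι₀ Y ∧ m' = m * k := by
  have hσ : ∀ W : NormalBelow ι₀ Y, ∃ σ : Point ι₀ (ι₀.obj W.1),
      m • σ = m' • std ι₀ W.1 ∧ push hG (ι₀.map (homOfLE W.2.choose)) σ = std ι₀ Y := fun W => by
    -- The element `k` should satisfy `m • (k • std) = m' • std`. As the action commutes with
    -- push-forward, the automorphism carrying `m • std` to `m' • std` also gives the value of `k`
    -- at `W`.
    obtain ⟨g, hg, hg'⟩ := exists_iso_push_eq hG W.2.choose_spec
      (r := m • std ι₀ W.1) (r' := m' • std ι₀ W.1) (by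
        rw [← smul_push, ← smul_push, push_std, h])
    refine ⟨push hG g.hom (std ι₀ W.1), by rw [smul_push, hg'], ?_⟩
    rw [← push_comp, hg, push_std]
  choose σ hmσ hpσ using hσ
  have hcomp : ∀ (W W' : NormalBelow ι₀ Y) (l : W.1 ≤ W'.1),
      push hG (ι₀.map (homOfLE l)) (σ W) = σ W' := by
    intro W W' l
    -- The two points differ by an automorphism `g`. After applying `m`, both become `m' • std`, so
    -- `g` fixes a point and is the identity.
    obtain ⟨g, -, hg'⟩ := exists_iso_push_eq hG W'.2.choose_spec
      (r := push hG (ι₀.map (homOfLE l)) (σ W)) (r' := σ W') (by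
        rw [push_map_comp hG _ _ (homOfLE W.2.choose), hpσ, hpσ])
    have e : push hG g.hom (m' • std ι₀ W'.1) = push hG (𝟙 _) (m' • std ι₀ W'.1) := by
      rw [push_id]
      conv_lhs => rw [← push_std hG (homOfLE l), smul_push, ← hmσ W, ← smul_push, ← smul_push, hg']
      exact hmσ W'
    rw [push_injective_hom hG _ e, push_id] at hg'
    exact hg'
  obtain ⟨k, hk⟩ := exists_smul_std_eq_of_cofinal hG (fun W : NormalBelow ι₀ Y => W.1) σ
    (fun V => by
      obtain ⟨W, hW, -⟩ := NormalBelow.exists_le_le hY hG hE V V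
      exact ⟨W, hW⟩)
    (fun W W' => by
      obtain ⟨W'', h, h'⟩ := NormalBelow.exists_le_le hY hG hE W.1 W'.1
      exact ⟨W'', homOfLE h, homOfLE h', hcomp _ _ h, hcomp _ _ h'⟩)
  refine ⟨k, ?_, GaloisMonoid.ext_of_smul fun V => ?_⟩
  · obtain ⟨W, -, -⟩ := NormalBelow.exists_le_le hY hG hE Y Y
    rw [← push_std hG (homOfLE W.2.choose), smul_push, hk, hpσ, push_std]
  · obtain ⟨W, hW, -⟩ := NormalBelow.exists_le_le hY hG hE V V
    rw [← push_std hG (homOfLE hW), smul_push, smul_push, mul_smul, hk, hmσ]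

theorem exists_eq_mul_of_smul_eq (hY : IsYSite.{w} J) (hG : IsGrid J ι₀) {X : C}
    {p : Point ι₀ X} (hp : Edge J p) {m m' : GaloisMonoid ι₀} (h : m • p = m' • p) :
    ∃ k : GaloisMonoid ι₀, k • p = p ∧ m' = m * k := by
  obtain ⟨k, hk, e⟩ := exists_eq_mul_of_smul_std_eq hY hG hp (m := m) (m' := m') (by
    have h' : push hG p.iso.hom p = std ι₀ p.base := Lies.push_eq hG ⟨𝟙 _, by simp [std]⟩
    rw [← h', smul_push, smul_push, h])
  exact ⟨k, (smul_eq_self_iff hG p k).2 ((mem_stab_iff k _).2 hk), e⟩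

end Transitivity

/-! ### Germs of sections; faithfulness and fullness. -/

section Germ

variable {C : Type u} [Category.{v} C] {J : GrothendieckTopology C} {C₀ : Type w}
  [PartialOrder C₀] {ι₀ : C₀ ⥤ C}

open Point

/-- The class in `ω(F)` of a section of `F` over `X`, at a point of `X`. -/
noncomputable def germ (hB : IsBSite J) (hG : IsGrid J ι₀) (F : Cᵒᵖ ⥤ Type w) {X : C}
    (p : Point ι₀ X) (x : F.obj (op X)) : fiber J ι₀ F :=
  (fiberIso hB hG F).inv (colimit.ι (ι₀.op ⋙ F) (op p.base) (F.map p.iso.inv.op x))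

theorem ι_eq_germ (hB : IsBSite J) (hG : IsGrid J ι₀) (F : Cᵒᵖ ⥤ Type w)
    (E : (IsEdge J ι₀).FullSubcategory) (x : F.obj (op (ι₀.obj E.obj))) :
    colimit.ι ((IsEdge J ι₀).ι.op ⋙ ι₀.op ⋙ F) (op E) x = germ hB hG F (std ι₀ E.obj) x := by
  have h := (Iso.eq_comp_inv _).2 (ι_fiberIso_hom hB hG F E)
  have h' := ConcreteCategory.congr_hom h x
  refine h'.trans ?_
  have e : F.map (std ι₀ E.obj).iso.inv.op x = x :=
    ConcreteCategory.congr_hom (F.map_id (op (ι₀.obj E.obj))) x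
  unfold germ
  rw [e]
  rfl

theorem exists_germ_eq (hB : IsBSite J) (hG : IsGrid J ι₀) (F : Cᵒᵖ ⥤ Type w)
    (s : fiber J ι₀ F) :
    ∃ E : C₀, IsEdge J ι₀ E ∧ ∃ x, germ hB hG F (std ι₀ E) x = s := by
  obtain ⟨E, x, rfl⟩ := Types.jointly_surjective' s
  exact ⟨E.unop.obj, E.unop.property, x, (ι_eq_germ hB hG F E.unop x).symm⟩

theorem act_germ (hB : IsBSite J) (hG : IsGrid J ι₀) (F : Cᵒᵖ ⥤ Type w) (m : GaloisMonoid ι₀)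
    {X : C} (p : Point ι₀ X) (x : F.obj (op X)) :
    act hB hG F m (germ hB hG F p x) = germ hB hG F (m • p) x := by
  rw [act_eq]
  unfold germ
  rw [types_comp_apply, types_comp_apply, Iso.inv_hom_id_apply]
  have h := ConcreteCategory.congr_hom (ι_actAll F m p.base) (F.map p.iso.inv.op x)
  refine congrArg (fiberIso hB hG F).inv (h.trans ?_)
  refine congrArg (colimit.ι (ι₀.op ⋙ F) (op (m.α.obj p.base))) ?_
  rw [smul_iso_inv, op_comp, F.map_comp]
  rfl

theorem germ_push (hB : IsBSite J) (hG : IsGrid J ι₀) (F : Cᵒᵖ ⥤ Type w) {X Y : C} (f : X ⟶ Y)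
    (p : Point ι₀ X) (y : F.obj (op Y)) :
    germ hB hG F (push hG f p) y = germ hB hG F p (F.map f.op y) := by
  obtain ⟨h, e⟩ := lies_push hG f p
  generalize push hG f p = q at h e
  refine congrArg (fiberIso hB hG F).inv ?_
  have h₁ := ConcreteCategory.congr_hom (colimit.w (ι₀.op ⋙ F) h.op) (F.map q.iso.inv.op y)
  refine h₁.symm.trans ?_
  refine congrArg (colimit.ι (ι₀.op ⋙ F) (op p.base)) ?_
  show (F.map q.iso.inv.op ≫ F.map (ι₀.map h).op) y = (F.map f.op ≫ F.map p.iso.inv.op) y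
  rw [← F.map_comp, ← F.map_comp, ← op_comp, ← op_comp]
  have e' : ι₀.map h ≫ q.iso.inv = p.iso.inv ≫ f := by
    rw [Iso.comp_inv_eq, Category.assoc, e, Iso.inv_hom_id_assoc]
  rw [e']

theorem fiberMap_germ (hB : IsBSite J) (hG : IsGrid J ι₀) {F F' : Cᵒᵖ ⥤ Type w} (t : F ⟶ F')
    {X : C} (p : Point ι₀ X) (x : F.obj (op X)) :
    fiberMap J ι₀ t (germ hB hG F p x) = germ hB hG F' p (t.app (op X) x) := by
  obtain ⟨E, hE, -⟩ := hG.exists_edge X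
  obtain ⟨U, u, -, -, b, rfl, -⟩ := exists_common hG p (std ι₀ E)
  have hU : IsEdge J ι₀ U := edge_of_hom hB hE b
  rw [germ_push, germ_push, ← ι_eq_germ hB hG F ⟨U, hU⟩, ← NatTrans.naturality_apply,
    ← ι_eq_germ hB hG F' ⟨U, hU⟩]
  exact ConcreteCategory.congr_hom (ι_fiberMap J ι₀ t ⟨U, hU⟩) (F.map u.op x)

/-- In the filtered colimit, every transition map out of an edge object is restriction along a
member of `T(J)`, hence injective. -/
theorem germ_injective (hB : IsBSite J) (hG : IsGrid J ι₀) {F : Cᵒᵖ ⥤ Type w}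
    (hF : ∀ {X Y : C} (f : Y ⟶ X), coverMor J f → Function.Injective (F.map f.op))
    {X : C} {p : Point ι₀ X} (hp : Edge J p) : Function.Injective (germ hB hG F p) := by
  intro x x' h
  have : IsCodirectedOrder C₀ := ⟨fun X Y => by
    obtain ⟨Z, ⟨f⟩, ⟨g⟩⟩ := hG.lambdaConnected X Y
    exact ⟨Z, leOfHom f, leOfHom g⟩⟩
  have : Nonempty C₀ := ⟨p.base⟩
  have h₁ := ((fiberIso hB hG F).toEquiv.symm).injective h
  obtain ⟨k, f, g, e⟩ := (Types.FilteredColimit.colimit_eq_iff (ι₀.op ⋙ F)).1 h₁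
  obtain rfl : f = g := Quiver.Hom.unop_inj (Subsingleton.elim _ _)
  exact hF _ (coverMor_of_isIso hB _) (hF _ (hp _ f.unop) e)

/-- The sections of a sheaf over `X` are the elements of the fiber which are fixed by the
stabilizer of an edge point of `X`. -/
theorem exists_germ_eq_of_fixed (hY : IsYSite.{w} J) (hG : IsGrid J ι₀)
    (hcard : ∀ X : CoverCat J, HomFinite (Over X) ∨ CountablyGenerated (Over X))
    {F : Cᵒᵖ ⥤ Type w} (hF : Presieve.IsSheaf J F) {X : C} {p : Point ι₀ X} (hp : Edge J p)
    (s : fiber J ι₀ F)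
    (hs : ∀ k : GaloisMonoid ι₀, k • p = p → act hY.toIsBSite hG F k s = s) :
    ∃ x, germ hY.toIsBSite hG F p x = s := by
  have hB := hY.toIsBSite
  obtain ⟨E, -, y, rfl⟩ := exists_germ_eq hB hG F s
  obtain ⟨U, u, u', a, -, hu, hu'⟩ := exists_common hG p (std ι₀ E)
  rw [← hu', germ_push] at hs ⊢
  generalize F.map u'.op y = y at hs ⊢
  have hpu : Edge J (push hG u (std ι₀ U)) := by rwa [hu]
  have hcov : coverMor J u := by
    have hl := lies_push hG u (std ι₀ U)
    rw [hu] at hl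
    obtain ⟨h, e⟩ := hl
    have h₁ : coverMor J (u ≫ p.iso.hom) := by
      rw [e]
      exact coverMor_comp (coverMor_of_isIso hB _) (hp _ h)
    exact coverMor_of_comp_right hB h₁
  -- After refinement, `s` is the germ at `r` of a section `y` over an object normal over `X`.
  obtain ⟨W, g, hg, hn⟩ := hY.exists_normal hcov
  obtain ⟨r, hr⟩ := exists_push_eq hB hG (coverMor_of_comp_right hB hg) (std ι₀ U)
  rw [← hr, germ_push] at hs ⊢
  generalize F.map g.op y = y at hs ⊢
  rw [← hr, ← push_comp] at hu hpu
  generalize g ≫ u = f at hg hn hu hpu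
  have hre : Edge J r := hpu.of_push hB hG
  obtain ⟨x, hx⟩ := exists_map_eq_of_isSheaf hF hg hn y (fun i hi => by
    -- The deck transformation `i` is realized at `r` by some `k`, which fixes `p` because `i` lies
    -- over `X`. Invariance of `s` under `k` then reads `i^* y = y`.
    obtain ⟨k, hk⟩ := exists_smul_eq hY hG hcard hre (push hG i.hom r)
    have hkp : k • p = p := by
      rw [← hu, smul_push, hk, ← push_comp, hi]
    have h₁ := hs k hkp
    rw [act_germ, hk, germ_push] at h₁
    exact germ_injective hB hG (fun _ h => map_injective_of_isSheaf hF h) hre h₁)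
  exact ⟨x, by rw [← hu, germ_push, hx]⟩

theorem fiberFunctor_faithful (hY : IsYSite.{w} J) (hG : IsGrid J ι₀) :
    (fiberFunctor hY hG).Faithful where
  map_injective {F F'} t t' h := by
    have h₁ : fiberMap J ι₀ t.hom = fiberMap J ι₀ t'.hom :=
      congrArg (fun φ => φ.hom.hom) h
    refine ObjectProperty.hom_ext _ (NatTrans.ext (funext fun X => ?_))
    ext x
    obtain ⟨p, hp⟩ := exists_edge_point hG X.unop
    refine germ_injective hY.toIsBSite hG
      (fun _ h => map_injective_of_isSheaf ((isSheaf_iff_isSheaf_of_type _ _).1 F'.property) h)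
      hp ?_
    have e₁ := fiberMap_germ hY.toIsBSite hG t.hom p x
    rw [h₁, fiberMap_germ] at e₁
    exact e₁.symm

theorem fiberFunctor_full (hY : IsYSite.{w} J) (hG : IsGrid J ι₀)
    (hcard : ∀ X : CoverCat J, HomFinite (Over X) ∨ CountablyGenerated (Over X)) :
    (fiberFunctor hY hG).Full where
  map_surjective {F F'} φ := by
    have hB := hY.toIsBSite
    have hF' : Presieve.IsSheaf J F'.obj := (isSheaf_iff_isSheaf_of_type _ _).1 F'.property
    let ψ : fiber J ι₀ F.obj ⟶ fiber J ι₀ F'.obj := φ.hom.hom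
    have hψ : ∀ (m : GaloisMonoid ι₀) s,
        ψ (act hB hG F.obj m s) = act hB hG F'.obj m (ψ s) := fun m s =>
      ConcreteCategory.congr_hom (φ.hom.comm m) s
    have ht : ∀ (X : C) (x : F.obj.obj (op X)), ∃ y : F'.obj.obj (op X),
        ∀ p : Point ι₀ X, germ hB hG F'.obj p y = ψ (germ hB hG F.obj p x) := fun X x => by
      obtain ⟨p, hp⟩ := exists_edge_point hG X
      -- Equivariance makes this germ fixed by the stabilizer of `p`; transitivity then propagates
      -- the identity from `p` to every point of `X`.
      obtain ⟨y, hy⟩ := exists_germ_eq_of_fixed hY hG hcard hF' hp (ψ (germ hB hG F.obj p x))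
        (fun k hk => by rw [← hψ, act_germ, hk])
      refine ⟨y, fun q => ?_⟩
      obtain ⟨m, rfl⟩ := exists_smul_eq hY hG hcard hp q
      rw [← act_germ, hy, ← hψ, act_germ]
    choose t ht using ht
    let τ : F.obj ⟶ F'.obj :=
      { app := fun X => ↾(t X.unop)
        naturality := fun X Y f => by
          ext x
          obtain ⟨p, hp⟩ := exists_edge_point hG Y.unop
          refine germ_injective hB hG (fun _ h => map_injective_of_isSheaf hF' h) hp ?_
          show germ hB hG F'.obj p (t Y.unop (F.obj.map f x)) =
            germ hB hG F'.obj p (F'.obj.map f.unop.op (t X.unop x))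
          rw [ht, ← germ_push, ht, germ_push]
          rfl }
    refine ⟨ObjectProperty.homMk τ, ?_⟩
    refine ObjectProperty.hom_ext _ (Action.hom_ext _ _ ?_)
    show fiberMap J ι₀ τ = ψ
    refine ConcreteCategory.hom_ext _ _ fun s => ?_
    obtain ⟨E, -, x, rfl⟩ := exists_germ_eq hB hG F.obj s
    rw [fiberMap_germ]
    exact ht _ _ _

end Germ

/-! ### The sheaf attached to a smooth set; essential surjectivity. -/

section EssSurj

variable {C : Type u} [Category.{v} C] {J : GrothendieckTopology C} {C₀ : Type w}
  [PartialOrder C₀] {ι₀ : C₀ ⥤ C}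

open Point

/-- This makes `m • p ↦ m • s` well defined, so that a fixed element becomes an equivariant function
on points. -/
theorem smul_eq_smul_of_fixed (hY : IsYSite.{w} J) (hG : IsGrid J ι₀) {S : Type*}
    [MulAction (GaloisMonoid ι₀) S] {X : C} {p : Point ι₀ X} (hp : Edge J p) {s : S}
    (hs : ∀ k : GaloisMonoid ι₀, k • p = p → k • s = s) {m m' : GaloisMonoid ι₀}
    (h : m • p = m' • p) : m • s = m' • s := by
  obtain ⟨k, hk, rfl⟩ := exists_eq_mul_of_smul_eq hY hG hp h
  rw [mul_smul, hs k hk]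

/-- A chosen edge point of `X`. -/
noncomputable def basePoint (hG : IsGrid J ι₀) (X : C) : Point ι₀ X :=
  (exists_edge_point hG X).choose

theorem basePoint_edge (hG : IsGrid J ι₀) (X : C) : Edge J (basePoint hG X) :=
  (exists_edge_point hG X).choose_spec

/-- The elements of an `M`-set which are fixed by the stabilizer of the chosen point of `X`. -/
def FixedSections (hG : IsGrid J ι₀) (S : Type w) [MulAction (GaloisMonoid ι₀) S] (X : C) :
    Type w :=
  {s : S // ∀ k : GaloisMonoid ι₀, k • basePoint hG X = basePoint hG X → k • s = s}

variable (hY : IsYSite.{w} J) (hG : IsGrid J ι₀)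
  (hcard : ∀ X : CoverCat J, HomFinite (Over X) ∨ CountablyGenerated (Over X))

/-- An element of the Galois monoid sending the chosen point of `X` to a given point. -/
noncomputable def mover {X : C} (p : Point ι₀ X) : GaloisMonoid ι₀ :=
  (exists_smul_eq hY hG hcard (basePoint_edge hG X) p).choose

theorem mover_smul {X : C} (p : Point ι₀ X) : mover hY hG hcard p • basePoint hG X = p :=
  (exists_smul_eq hY hG hcard (basePoint_edge hG X) p).choose_spec

variable {S : Type w} [MulAction (GaloisMonoid ι₀) S]

/-- The value at a point of `X` of an element fixed by the stabilizer of the chosen point. -/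
noncomputable def evalAt {X : C} (p : Point ι₀ X) (s : FixedSections hG S X) : S :=
  mover hY hG hcard p • s.1

theorem evalAt_eq {X : C} {p : Point ι₀ X} (s : FixedSections hG S X) {m : GaloisMonoid ι₀}
    (h : m • basePoint hG X = p) : evalAt hY hG hcard p s = m • s.1 :=
  smul_eq_smul_of_fixed hY hG (basePoint_edge hG X) s.2 ((mover_smul hY hG hcard p).trans h.symm)

theorem smul_evalAt {X : C} (p : Point ι₀ X) (s : FixedSections hG S X) (m : GaloisMonoid ι₀) :
    m • evalAt hY hG hcard p s = evalAt hY hG hcard (m • p) s := by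
  rw [evalAt_eq hY hG hcard s (m := m * mover hY hG hcard p) (p := m • p), mul_smul]
  · rfl
  · rw [mul_smul, mover_smul]

theorem evalAt_injective {X : C} {p : Point ι₀ X} (hp : Edge J p) :
    Function.Injective (evalAt hY hG hcard p : FixedSections hG S X → S) := by
  intro s t h
  -- Transitivity starting from the edge point `p` replaces the missing inverse of `mover`.
  obtain ⟨n, hn⟩ := exists_smul_eq hY hG hcard hp (basePoint hG X)
  have h' := congrArg (n • ·) h
  simp only [smul_evalAt, hn] at h'
  rw [evalAt_eq hY hG hcard s (one_smul _ _), evalAt_eq hY hG hcard t (one_smul _ _), one_smul,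
    one_smul] at h'
  exact Subtype.ext h'

theorem exists_evalAt_eq {X : C} {p : Point ι₀ X} (hp : Edge J p) {t : S}
    (ht : ∀ k : GaloisMonoid ι₀, k • p = p → k • t = t) :
    ∃ s : FixedSections hG S X, evalAt hY hG hcard p s = t := by
  obtain ⟨n, hn⟩ := exists_smul_eq hY hG hcard hp (basePoint hG X)
  refine ⟨⟨n • t, fun k hk => ?_⟩, ?_⟩
  · rw [← mul_smul]
    exact smul_eq_smul_of_fixed hY hG hp ht (by rw [mul_smul, hn, hk])
  · show mover hY hG hcard p • n • t = t
    rw [← mul_smul]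
    exact ht _ (by rw [mul_smul, hn, mover_smul])

/-- Restriction of fixed sections along a morphism of `C`. -/
noncomputable def FixedSections.res {X Y : C} (f : X ⟶ Y) (s : FixedSections hG S Y) :
    FixedSections hG S X :=
  ⟨evalAt hY hG hcard (push hG f (basePoint hG X)) s, fun k hk => by
    rw [smul_evalAt, smul_push, hk]⟩

theorem evalAt_res {X Y : C} (f : X ⟶ Y) (p : Point ι₀ X) (s : FixedSections hG S Y) :
    evalAt hY hG hcard p (s.res hY hG hcard f) = evalAt hY hG hcard (push hG f p) s := by
  show mover hY hG hcard p • evalAt hY hG hcard (push hG f (basePoint hG X)) s = _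
  rw [smul_evalAt, smul_push, mover_smul]

variable (S) in
/-- The presheaf on `C` attached to an `M`-set. -/
noncomputable def fixedPresheaf : Cᵒᵖ ⥤ Type w where
  obj X := FixedSections hG S X.unop
  map f := ↾(fun s => s.res hY hG hcard f.unop)
  map_id X := by
    refine ConcreteCategory.hom_ext _ _ fun s =>
      evalAt_injective hY hG hcard (basePoint_edge hG X.unop) ?_
    show evalAt hY hG hcard _ (FixedSections.res hY hG hcard (𝟙 X.unop) s) = _
    rw [evalAt_res, push_id]
    rfl
  map_comp {X Y Z} f g := by
    refine ConcreteCategory.hom_ext _ _ fun s =>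
      evalAt_injective hY hG hcard (basePoint_edge hG Z.unop) ?_
    show evalAt hY hG hcard _ (FixedSections.res hY hG hcard (g.unop ≫ f.unop) s) =
      evalAt hY hG hcard _
        (FixedSections.res hY hG hcard g.unop (FixedSections.res hY hG hcard f.unop s))
    rw [evalAt_res, evalAt_res, evalAt_res, push_comp]

/-- The value at a point of `X` of a section over `X` of the presheaf attached to an `M`-set. -/
noncomputable def value {X : C} (p : Point ι₀ X)
    (s : (fixedPresheaf hY hG hcard S).obj (op X)) : S :=
  evalAt hY hG hcard p (show FixedSections hG S X from s)

theorem smul_value {X : C} (p : Point ι₀ X) (s : (fixedPresheaf hY hG hcard S).obj (op X))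
    (m : GaloisMonoid ι₀) : m • value hY hG hcard p s = value hY hG hcard (m • p) s :=
  smul_evalAt hY hG hcard p _ m

theorem value_injective {X : C} {p : Point ι₀ X} (hp : Edge J p) :
    Function.Injective (value hY hG hcard (S := S) p) :=
  evalAt_injective hY hG hcard hp

theorem exists_value_eq {X : C} {p : Point ι₀ X} (hp : Edge J p) {t : S}
    (ht : ∀ k : GaloisMonoid ι₀, k • p = p → k • t = t) :
    ∃ s, value hY hG hcard p s = t :=
  exists_evalAt_eq hY hG hcard hp ht

theorem value_map {X Y : C} (f : X ⟶ Y) (p : Point ι₀ X) (s : (fixedPresheaf hY hG hcard S).obj (op Y)) :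
    value hY hG hcard p ((fixedPresheaf hY hG hcard S).map f.op s) =
      value hY hG hcard (push hG f p) s :=
  evalAt_res hY hG hcard f p s

theorem fixedPresheaf_map_injective {X Y : C} {f : Y ⟶ X} (hf : coverMor J f) :
    Function.Injective ((fixedPresheaf hY hG hcard S).map f.op) := by
  intro s t h
  obtain ⟨r, hr⟩ := exists_push_eq hY.toIsBSite hG hf (basePoint hG X)
  refine value_injective hY hG hcard (basePoint_edge hG X) ?_
  rw [← hr, ← value_map, h, value_map]

theorem fixedPresheaf_isSheaf : Presieve.IsSheaf J (fixedPresheaf hY hG hcard S) := by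
  refine isSheaf_of_normal hY _ (fun f hf => fixedPresheaf_map_injective hY hG hcard hf) ?_
  intro X Y f hf hn y hy
  obtain ⟨r, hr⟩ := exists_push_eq hY.toIsBSite hG hf (basePoint hG X)
  have hr' : Edge J r := Edge.of_push hY.toIsBSite hG (f := f) (by
    rw [hr]
    exact basePoint_edge hG X)
  obtain ⟨x, hx⟩ := exists_value_eq hY hG hcard (basePoint_edge hG X)
    (t := value hY hG hcard r y) (fun k hk => by
      -- An element fixing the base point acts on `r` like an automorphism `g` of `Y` over `X`, and
      -- `y` is invariant under `g`.
      obtain ⟨g, hg, hg'⟩ := exists_iso_push_eq hG hn (r := r) (r' := k • r) (by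
        rw [← smul_push, hr, hk])
      rw [smul_value, ← hg', ← value_map, hy g hg])
  refine ⟨x, value_injective hY hG hcard hr' ?_⟩
  rw [value_map, hr, hx]

variable (S) in
/-- The cocone given by the values of sections at the tautological points of edge objects. -/
noncomputable def valueCocone :
    Cocone ((IsEdge J ι₀).ι.op ⋙ ι₀.op ⋙ fixedPresheaf hY hG hcard S) where
  pt := S
  ι :=
    { app := fun E => ↾(value hY hG hcard (S := S) (std ι₀ E.unop.obj))
      naturality := fun E E' f => by
        refine ConcreteCategory.hom_ext _ _ fun s => ?_
        refine (value_map hY hG hcard (ι₀.map f.unop.hom) (std ι₀ E'.unop.obj) s).trans ?_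
        rw [push_std]
        rfl }

/-- The comparison map from the fiber of the sheaf attached to an `M`-set. -/
noncomputable def fiberEval : fiber J ι₀ (fixedPresheaf hY hG hcard S) ⟶ S :=
  colimit.desc _ (valueCocone hY hG hcard S)

theorem fiberEval_germ {X : C} (p : Point ι₀ X) (s : (fixedPresheaf hY hG hcard S).obj (op X)) :
    fiberEval hY hG hcard (germ hY.toIsBSite hG (fixedPresheaf hY hG hcard S) p s) =
      value hY hG hcard p s := by
  obtain ⟨E, hE, -⟩ := hG.exists_edge X
  obtain ⟨U, u, -, -, b, rfl, -⟩ := exists_common hG p (std ι₀ E)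
  have hU : IsEdge J ι₀ U := edge_of_hom hY.toIsBSite hE b
  rw [germ_push, ← ι_eq_germ hY.toIsBSite hG _ ⟨U, hU⟩, ← value_map]
  exact ConcreteCategory.congr_hom
    (colimit.ι_desc (valueCocone hY hG hcard S) (op (⟨U, hU⟩ : (IsEdge J ι₀).FullSubcategory))) _

theorem fiberEval_act (m : GaloisMonoid ι₀) (x : fiber J ι₀ (fixedPresheaf hY hG hcard S)) :
    fiberEval hY hG hcard (act hY.toIsBSite hG _ m x) = m • fiberEval hY hG hcard x := by
  obtain ⟨E, -, s, rfl⟩ := exists_germ_eq hY.toIsBSite hG _ x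
  rw [act_germ, fiberEval_germ, fiberEval_germ, smul_value]

theorem fiberEval_injective :
    Function.Injective (fiberEval hY hG hcard (S := S)) := by
  intro x y h
  obtain ⟨E, hE, s, rfl⟩ := exists_germ_eq hY.toIsBSite hG _ x
  obtain ⟨E', -, t, rfl⟩ := exists_germ_eq hY.toIsBSite hG _ y
  obtain ⟨U, u, u', a, -, hu, hu'⟩ := exists_common hG (std ι₀ E) (std ι₀ E')
  have hU : Edge J (std ι₀ U) := edge_of_hom hY.toIsBSite hE a
  rw [← hu, ← hu', germ_push, germ_push] at h ⊢
  rw [fiberEval_germ, fiberEval_germ] at h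
  rw [value_injective hY hG hcard hU h]

/-- Smoothness says that `s` is fixed by the stabilizer of the tautological point of an edge object,
so it is the value there of a section. -/
theorem fiberEval_surjective
    (hS : ∀ s : S, ∃ E : C₀, IsEdge J ι₀ E ∧ ∀ g ∈ stab ι₀ E, g • s = s) :
    Function.Surjective (fiberEval hY hG hcard (S := S)) := by
  intro s
  obtain ⟨E, hE, h⟩ := hS s
  obtain ⟨x, hx⟩ := exists_value_eq hY hG hcard (p := std ι₀ E) hE (t := s)
    (fun k hk => h k ((mem_stab_iff k E).2 hk))
  exact ⟨germ hY.toIsBSite hG _ (std ι₀ E) x, by rw [fiberEval_germ, hx]⟩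

/-- The multiplicative action underlying an object of the category of actions on sets. -/
@[reducible]
def actionMulAction {M : Type*} [Monoid M] (S : Action (Type w) M) : MulAction M S.V where
  smul m s := (S.ρ m : S.V ⟶ S.V) s
  one_smul s := ConcreteCategory.congr_hom (S.ρ.map_one : (S.ρ 1 : S.V ⟶ S.V) = 𝟙 S.V) s
  mul_smul m n s := ConcreteCategory.congr_hom
    (S.ρ.map_mul m n : (S.ρ (m * n) : S.V ⟶ S.V) = (S.ρ n : S.V ⟶ S.V) ≫ (S.ρ m : S.V ⟶ S.V)) s

theorem fiberFunctor_essSurj (hY : IsYSite.{w} J) (hG : IsGrid J ι₀)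
    (hcard : ∀ X : CoverCat J, HomFinite (Over X) ∨ CountablyGenerated (Over X)) :
    (fiberFunctor hY hG).EssSurj where
  mem_essImage S := by
    let := actionMulAction S.obj
    let F : Sheaf J (Type w) := ⟨fixedPresheaf hY hG hcard S.obj.V,
      (isSheaf_iff_isSheaf_of_type _ _).2 (fixedPresheaf_isSheaf hY hG hcard)⟩
    let e : ((fiberFunctor hY hG).obj F).obj.V ≅ S.obj.V :=
      (Equiv.ofBijective (fiberEval hY hG hcard (S := S.obj.V))
        ⟨fiberEval_injective hY hG hcard, fiberEval_surjective hY hG hcard S.property⟩).toIso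
    refine ⟨F, ⟨(IsSmooth J ι₀).isoMk (Action.mkIso e fun m => ?_)⟩⟩
    exact ConcreteCategory.hom_ext _ _ fun x => fiberEval_act hY hG hcard m x

end EssSurj

end YSites

theorem theorem5p1 {C : Type u} [Category.{v} C] (J : GrothendieckTopology C)
    (hY : YSites.IsYSite.{w} J) {C₀ : Type w} [PartialOrder C₀] (ι₀ : C₀ ⥤ C)
    (hG : YSites.IsGrid J ι₀) :
    (YSites.fiberFunctor hY hG).Faithful ∧
      ((∀ X : YSites.CoverCat J,
          YSites.HomFinite (Over X) ∨ YSites.CountablyGenerated (Over X)) →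
        (YSites.fiberFunctor hY hG).IsEquivalence) := by
  refine ⟨YSites.fiberFunctor_faithful hY hG, fun hcard => ?_⟩
  exact
    { faithful := YSites.fiberFunctor_faithful hY hG
      full := YSites.fiberFunctor_full hY hG hcard
      essSurj := YSites.fiberFunctor_essSurj hY hG hcard }
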